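/- Let $r \in \{0,1,3,5\}$ and let $N$ be an odd square-free integer. Let $E$ be an elliptic curve over $\mathbb{Q}$ with full rational $2$-torsion, i.e. $E(\mathbb{Q})[2] \cong (\mathbb{Z}/2\mathbb{Z})^2$, and suppose that the conductor of $E$ is $2^r N$. Then there are coprime integers $A, B$ with $A \equiv -1 \pmod 4$ and $2 \mid B$ such that $E$ is isomorphic over $\mathbb{Q}$ to the curve given by the Weierstrass equation $$E_{A,B} : Y^2 = X(X-A)(X+B).$$ -/

import Mathlib

/-- The Kodaira symbols, i.e. the types of special fibres of minimal regular models of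
elliptic curves over a discrete valuation ring. -/
inductive KodairaSymbol : Type
  /-- `Iₙ`, where `I₀` is good reduction -/
  | I (n : ℕ)
  | II
  | III
  | IV
  /-- `Iₙ*` -/
  | IStar (n : ℕ)
  | IVStar
  | IIIStar
  | IIStar

/-- The number of irreducible components, counted without multiplicity, of the geometric special
fibre of the minimal regular model. -/
def KodairaSymbol.numComponents : KodairaSymbol → ℕ
  | .I 0 => 1
  | .I (n + 1) => n + 1
  | .II => 1
  | .III => 2
  | .IV => 3
  | .IStar n => n + 5
  | .IVStar => 7
  | .IIIStar => 8
  | .IIStar => 9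

namespace WeierstrassCurve

/-- The integral Weierstrass equation `W` over a discrete valuation ring `R` with uniformizer `π`
(and perfect residue field) is in the form in which Tate's algorithm stops with the symbol `T`.

Writing `a_{i,j} = a_i / π ^ j`:
* for `I₀*` the cubic `T³ + a_{2,1} T² + a_{4,2} T + a_{6,3}` has three distinct roots in an
  algebraic closure of the residue field (the stated expression is `π ^ 6` times its discriminant);
* for `Iₙ*` with `n = 2k + 1` the quadratic `Y² + a_{3,k+2} Y - a_{6,2k+4}` has distinct roots
  (its discriminant is `b₆ / π ^ (2k+4)`);
* for `Iₙ*` with `n = 2k + 2` the quadratic `a_{2,1} X² + a_{4,k+3} X + a_{6,2k+5}` has distinct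
  roots;
* for `IV*` the quadratic `Y² + a_{3,2} Y - a_{6,4}` has distinct roots. -/
def IsTateForm {R : Type*} [CommRing R] (π : R) (W : WeierstrassCurve R) : KodairaSymbol → Prop
  | .I 0 => ¬ π ∣ W.Δ
  | .I (n + 1) => ¬ π ∣ W.c₄ ∧ π ^ (n + 1) ∣ W.Δ ∧ ¬ π ^ (n + 2) ∣ W.Δ
  | .II => π ∣ W.b₂ ∧ π ∣ W.a₃ ∧ π ∣ W.a₄ ∧ π ∣ W.a₆ ∧ ¬ π ^ 2 ∣ W.a₆
  | .III => π ∣ W.b₂ ∧ π ∣ W.a₃ ∧ π ∣ W.a₄ ∧ π ^ 2 ∣ W.a₆ ∧ ¬ π ^ 3 ∣ W.b₈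
  | .IV => π ∣ W.b₂ ∧ π ∣ W.a₃ ∧ π ∣ W.a₄ ∧ π ^ 2 ∣ W.a₆ ∧ π ^ 3 ∣ W.b₈ ∧ ¬ π ^ 3 ∣ W.b₆
  | .IStar 0 => π ∣ W.a₁ ∧ π ∣ W.a₂ ∧ π ^ 2 ∣ W.a₃ ∧ π ^ 2 ∣ W.a₄ ∧ π ^ 3 ∣ W.a₆ ∧
      ¬ π ^ 7 ∣ W.a₂ ^ 2 * W.a₄ ^ 2 - 4 * W.a₄ ^ 3 - 4 * W.a₂ ^ 3 * W.a₆ - 27 * W.a₆ ^ 2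
        + 18 * W.a₂ * W.a₄ * W.a₆
  | .IStar (n + 1) => π ∣ W.a₁ ∧ π ∣ W.a₂ ∧ ¬ π ^ 2 ∣ W.a₂ ∧ ∃ k : ℕ,
      (n = 2 * k ∧ π ^ (k + 2) ∣ W.a₃ ∧ π ^ (k + 3) ∣ W.a₄ ∧ π ^ (2 * k + 4) ∣ W.a₆ ∧
        ¬ π ^ (2 * k + 5) ∣ W.b₆) ∨
      (n = 2 * k + 1 ∧ π ^ (k + 3) ∣ W.a₃ ∧ π ^ (k + 3) ∣ W.a₄ ∧ π ^ (2 * k + 5) ∣ W.a₆ ∧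
        ¬ π ^ (2 * k + 7) ∣ W.a₄ ^ 2 - 4 * W.a₂ * W.a₆)
  | .IVStar => π ∣ W.a₁ ∧ π ^ 2 ∣ W.a₂ ∧ π ^ 2 ∣ W.a₃ ∧ π ^ 3 ∣ W.a₄ ∧ π ^ 4 ∣ W.a₆ ∧
      ¬ π ^ 5 ∣ W.b₆
  | .IIIStar => π ∣ W.a₁ ∧ π ^ 2 ∣ W.a₂ ∧ π ^ 3 ∣ W.a₃ ∧ π ^ 3 ∣ W.a₄ ∧ π ^ 5 ∣ W.a₆ ∧
      ¬ π ^ 4 ∣ W.a₄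
  | .IIStar => π ∣ W.a₁ ∧ π ^ 2 ∣ W.a₂ ∧ π ^ 3 ∣ W.a₃ ∧ π ^ 4 ∣ W.a₄ ∧ π ^ 5 ∣ W.a₆ ∧
      ¬ π ^ 6 ∣ W.a₆

/-- `W` is a minimal integral Weierstrass equation over `ℤ_p` of the elliptic curve `E`, in the form
in which Tate's algorithm stops with the symbol `T`. -/
def IsTateModel (E : WeierstrassCurve ℚ) (p : ℕ) [Fact p.Prime] (W : WeierstrassCurve ℤ_[p])
    (T : KodairaSymbol) : Prop :=
  (∃ C : VariableChange ℚ_[p], C • E.baseChange ℚ_[p] = W.baseChange ℚ_[p]) ∧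
    IsMinimal ℤ_[p] (W.baseChange ℚ_[p]) ∧ IsTateForm (p : ℤ_[p]) W T

/-- The exponent at `p` of the conductor of an elliptic curve `E` over `ℚ`, by Ogg's formula
`f = v(Δ_min) + 1 - m`, with `m` the number of components of the special fibre. The set below has
exactly one element, as the symbol and the valuation of the minimal discriminant are determined
by `E` and `p`. -/
noncomputable def conductorExponent (E : WeierstrassCurve ℚ) (p : ℕ) [Fact p.Prime] : ℕ :=
  sInf {f : ℕ | ∃ (W : WeierstrassCurve ℤ_[p]) (T : KodairaSymbol),
    IsTateModel E p W T ∧ f + T.numComponents = W.Δ.valuation + 1}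

/-- The conductor of an elliptic curve over `ℚ` (almost all of the exponents are zero). -/
noncomputable def conductor (E : WeierstrassCurve ℚ) : ℕ :=
  ∏ᶠ p : Nat.Primes, (p : ℕ) ^ (haveI : Fact (p : ℕ).Prime := ⟨p.2⟩; E.conductorExponent (p : ℕ))

/-- All four geometric 2-torsion points of `E` are rational: `E(ℚ)[2] ≅ (ℤ/2ℤ)²`. -/
def HasFullRationalTwoTorsion (E : WeierstrassCurve ℚ) : Prop :=
  Nonempty (AddSubgroup.torsionBy E.toAffine.Point 2 ≃+ ZMod 2 × ZMod 2)

/-- The Weierstrass equation `E_{A,B} : Y² = X (X - A) (X + B)`. -/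
def freyModel (A B : ℤ) : WeierstrassCurve ℚ where
  a₁ := 0
  a₂ := B - A
  a₃ := 0
  a₄ := -(A * B)
  a₆ := 0

theorem freyModel_equation_iff (A B : ℤ) (x y : ℚ) :
    (freyModel A B).toAffine.Equation x y ↔ y ^ 2 = x * (x - A) * (x + B) := by
  rw [Affine.equation_iff]
  simp only [freyModel]
  constructor <;> intro h <;> linear_combination h

end WeierstrassCurve

/-! ### Lower bounds for the discriminant of a Tate form -/

namespace WeierstrassCurve

section TateForm

variable {R : Type*} [CommRing R] {π : R} {W : WeierstrassCurve R}

/-! Moving one 2-torsion point to the origin and extracting squares writes `E` as Y² = X(X - dA)(X +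
dB) with `d` squarefree and `A`, `B` coprime. An odd prime dividing `d` forces additive reduction,
hence conductor exponent at least 2 (`two_le_conductorExponent`), against the squarefreeness of `N`.
If 2 divides `d`, the exponent at 2 can be neither less than 2 nor an odd number up to 5
(`not_odd_conductorExponent_two_of_ramified`). So `d` is ±1 and is absorbed into `A` and `B`;
permuting the 2-torsion makes `A` odd and `B` even. If A ≡ 1 mod 4 and 4 ∤ B, exchanging two roots
replaces (A, B) by (A + B, -B), and A + B ≡ -1 mod 4. The remaining case A ≡ 1 mod 4, 4 ∣ B again
contradicts the exponent at 2 (`not_odd_conductorExponent_two`).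

The uniqueness of the Kodaira symbol is never needed. One explicit Tate model shows that the set
defining the exponent is nonempty; the infimum is then attained by some Tate model, about which only
one thing is used: its Δ, c₄, c₆ agree with the explicit ones up to 12th, 4th and 6th powers of a
unit. Since Δ is a square, an odd exponent at most 5 confines any such model to a few symbols with
strong congruences on c₄ and c₆ (`IsTateForm.invariants_of_odd_conductorExponent`), which the
explicit invariants violate. -/

theorem pow_dvd_Δ_of_pow_dvd_b {i j k l m : ℕ} (h₂ : π ^ i ∣ W.b₂) (h₄ : π ^ j ∣ W.b₄)
    (h₆ : π ^ k ∣ W.b₆) (h₈ : π ^ l ∣ W.b₈) (hm₁ : m ≤ 2 * i + l) (hm₂ : m ≤ 3 * j)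
    (hm₃ : m ≤ 2 * k) (hm₄ : m ≤ i + j + k) : π ^ m ∣ W.Δ := by
  obtain ⟨b₂, h₂⟩ := h₂
  obtain ⟨b₄, h₄⟩ := h₄
  obtain ⟨b₆, h₆⟩ := h₆
  obtain ⟨b₈, h₈⟩ := h₈
  have e : W.Δ = -(π ^ (2 * i + l) * (b₂ ^ 2 * b₈)) - π ^ (3 * j) * (8 * b₄ ^ 3)
      - π ^ (2 * k) * (27 * b₆ ^ 2) + π ^ (i + j + k) * (9 * b₂ * b₄ * b₆) := by
    rw [Δ, h₂, h₄, h₆, h₈]; ring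
  rw [e]
  exact (((((pow_dvd_pow π hm₁).mul_right _).neg_right).sub ((pow_dvd_pow π hm₂).mul_right _)).sub
    ((pow_dvd_pow π hm₃).mul_right _)).add ((pow_dvd_pow π hm₄).mul_right _)

theorem pow_dvd_b₂ {i₁ i₂ m : ℕ} (h₁ : π ^ i₁ ∣ W.a₁) (h₂ : π ^ i₂ ∣ W.a₂)
    (hm₁ : m ≤ 2 * i₁) (hm₂ : m ≤ i₂) : π ^ m ∣ W.b₂ := by
  obtain ⟨a₁, h₁⟩ := h₁
  obtain ⟨a₂, h₂⟩ := h₂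
  have e : W.b₂ = π ^ (2 * i₁) * a₁ ^ 2 + π ^ i₂ * (4 * a₂) := by rw [b₂, h₁, h₂]; ring
  rw [e]
  exact ((pow_dvd_pow π hm₁).mul_right _).add ((pow_dvd_pow π hm₂).mul_right _)

theorem pow_dvd_b₄ {i₁ i₃ i₄ m : ℕ} (h₁ : π ^ i₁ ∣ W.a₁) (h₃ : π ^ i₃ ∣ W.a₃) (h₄ : π ^ i₄ ∣ W.a₄)
    (hm₁ : m ≤ i₁ + i₃) (hm₂ : m ≤ i₄) : π ^ m ∣ W.b₄ := by
  obtain ⟨a₁, h₁⟩ := h₁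
  obtain ⟨a₃, h₃⟩ := h₃
  obtain ⟨a₄, h₄⟩ := h₄
  have e : W.b₄ = π ^ i₄ * (2 * a₄) + π ^ (i₁ + i₃) * (a₁ * a₃) := by rw [b₄, h₁, h₃, h₄]; ring
  rw [e]
  exact ((pow_dvd_pow π hm₂).mul_right _).add ((pow_dvd_pow π hm₁).mul_right _)

theorem pow_dvd_b₆ {i₃ i₆ m : ℕ} (h₃ : π ^ i₃ ∣ W.a₃) (h₆ : π ^ i₆ ∣ W.a₆)
    (hm₁ : m ≤ 2 * i₃) (hm₂ : m ≤ i₆) : π ^ m ∣ W.b₆ := by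
  obtain ⟨a₃, h₃⟩ := h₃
  obtain ⟨a₆, h₆⟩ := h₆
  have e : W.b₆ = π ^ (2 * i₃) * a₃ ^ 2 + π ^ i₆ * (4 * a₆) := by rw [b₆, h₃, h₆]; ring
  rw [e]
  exact ((pow_dvd_pow π hm₁).mul_right _).add ((pow_dvd_pow π hm₂).mul_right _)

theorem pow_dvd_b₈ {i₁ i₂ i₃ i₄ i₆ m : ℕ} (h₁ : π ^ i₁ ∣ W.a₁) (h₂ : π ^ i₂ ∣ W.a₂)
    (h₃ : π ^ i₃ ∣ W.a₃) (h₄ : π ^ i₄ ∣ W.a₄) (h₆ : π ^ i₆ ∣ W.a₆)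
    (hm₁ : m ≤ 2 * i₁ + i₆) (hm₂ : m ≤ i₂ + i₆) (hm₃ : m ≤ i₁ + i₃ + i₄) (hm₄ : m ≤ i₂ + 2 * i₃)
    (hm₅ : m ≤ 2 * i₄) : π ^ m ∣ W.b₈ := by
  obtain ⟨a₁, h₁⟩ := h₁
  obtain ⟨a₂, h₂⟩ := h₂
  obtain ⟨a₃, h₃⟩ := h₃
  obtain ⟨a₄, h₄⟩ := h₄
  obtain ⟨a₆, h₆⟩ := h₆
  have e : W.b₈ = π ^ (2 * i₁ + i₆) * (a₁ ^ 2 * a₆) + π ^ (i₂ + i₆) * (4 * a₂ * a₆)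
      - π ^ (i₁ + i₃ + i₄) * (a₁ * a₃ * a₄) + π ^ (i₂ + 2 * i₃) * (a₂ * a₃ ^ 2)
      - π ^ (2 * i₄) * a₄ ^ 2 := by rw [b₈, h₁, h₂, h₃, h₄, h₆]; ring
  rw [e]
  exact ((((pow_dvd_pow π hm₁).mul_right _).add ((pow_dvd_pow π hm₂).mul_right _)).sub
    ((pow_dvd_pow π hm₃).mul_right _)).add ((pow_dvd_pow π hm₄).mul_right _) |>.sub
    ((pow_dvd_pow π hm₅).mul_right _)

/-- For additive reduction, the exponent in Ogg's formula is at least two. -/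
theorem IsTateForm.pow_numComponents_add_one_dvd_Δ {T : KodairaSymbol} (h : W.IsTateForm π T)
    (hc : π ∣ W.c₄) (hΔ : π ∣ W.Δ) : π ^ (T.numComponents + 1) ∣ W.Δ := by
  have one {x : R} (hx : π ∣ x) : π ^ 1 ∣ x := by rwa [pow_one]
  match T, h with
  | .I 0, h => exact absurd hΔ h
  | .I (n + 1), h => exact absurd hc h.1
  | .II, ⟨h₂, h₃, h₄, h₆, _⟩ =>
    have k₄ : π ^ 1 ∣ W.b₄ := pow_dvd_b₄ (i₁ := 0) (by simp) (one h₃) (one h₄) le_rfl le_rfl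
    have k₆ : π ^ 1 ∣ W.b₆ := pow_dvd_b₆ (one h₃) (one h₆) (by omega) le_rfl
    exact pow_dvd_Δ_of_pow_dvd_b (l := 0) (m := 2) (one h₂) k₄ k₆ (by simp)
      (by omega) (by omega) (by omega) (by omega)
  | .III, ⟨h₂, h₃, h₄, h₆, _⟩ =>
    have k₄ : π ^ 1 ∣ W.b₄ := pow_dvd_b₄ (i₁ := 0) (by simp) (one h₃) (one h₄) le_rfl le_rfl
    have k₆ : π ^ 2 ∣ W.b₆ := pow_dvd_b₆ (one h₃) h₆ (by omega) le_rfl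
    have k₈ : π ^ 1 ∣ W.b₈ := pow_dvd_b₈ (i₁ := 0) (i₂ := 0) (by simp) (by simp) (one h₃)
      (one h₄) h₆ (by omega) (by omega) (by omega) (by omega) (by omega)
    exact pow_dvd_Δ_of_pow_dvd_b (m := 3) (one h₂) k₄ k₆ k₈
      (by omega) (by omega) (by omega) (by omega)
  | .IV, ⟨h₂, h₃, h₄, h₆, h₈, _⟩ =>
    have k₄ : π ^ 1 ∣ W.b₄ := pow_dvd_b₄ (i₁ := 0) (by simp) (one h₃) (one h₄) le_rfl le_rfl
    have k₆ : π ^ 2 ∣ W.b₆ := pow_dvd_b₆ (one h₃) h₆ (by omega) le_rfl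
    obtain ⟨x₂, e₂⟩ := h₂
    obtain ⟨x₄, e₄⟩ := k₄
    obtain ⟨x₆, e₆⟩ := k₆
    obtain ⟨x₈, e₈⟩ := h₈
    have hb := W.b_relation
    refine ⟨-(π * x₂ ^ 2 * x₈) - 8 * x₄ * (x₂ * x₆ - 4 * x₈) - 27 * x₆ ^ 2
      + 9 * x₂ * x₄ * x₆, ?_⟩
    -- As π need not be prime, π² ∣ b₄ is not available. The relation 4b₈ = b₂b₆ - b₄² gives π³ ∣
    -- b₄², enough for the term 8b₄·b₄² of Δ.
    have hb' : W.b₄ ^ 2 = π ^ 3 * (x₂ * x₆ - 4 * x₈) := by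
      have : W.b₄ ^ 2 = W.b₂ * W.b₆ - 4 * W.b₈ := by rw [hb]; ring
      rw [this, e₂, e₆, e₈]; ring
    have : W.Δ = -W.b₂ ^ 2 * W.b₈ - 8 * W.b₄ * W.b₄ ^ 2 - 27 * W.b₆ ^ 2
      + 9 * W.b₂ * W.b₄ * W.b₆ := by rw [Δ]; ring
    rw [this, hb', e₂, e₄, e₆, e₈]
    simp only [KodairaSymbol.numComponents]
    ring
  | .IStar 0, ⟨h₁, h₂, h₃, h₄, h₆, _⟩ =>
    have k₂ : π ^ 1 ∣ W.b₂ := pow_dvd_b₂ (one h₁) (one h₂) (by omega) le_rfl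
    have k₄ : π ^ 2 ∣ W.b₄ := pow_dvd_b₄ (one h₁) h₃ h₄ (by omega) (by omega)
    have k₆ : π ^ 3 ∣ W.b₆ := pow_dvd_b₆ h₃ h₆ (by omega) le_rfl
    have k₈ : π ^ 4 ∣ W.b₈ := pow_dvd_b₈ (one h₁) (one h₂) h₃ h₄ h₆
      (by omega) (by omega) (by omega) (by omega) (by omega)
    exact pow_dvd_Δ_of_pow_dvd_b (m := 6) k₂ k₄ k₆ k₈ (by omega) (by omega) (by omega) (by omega)
  | .IStar (n + 1), ⟨h₁, h₂, _, k, .inl ⟨hn, h₃, h₄, h₆, _⟩⟩ =>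
    have k₂ : π ^ 1 ∣ W.b₂ := pow_dvd_b₂ (one h₁) (one h₂) (by omega) le_rfl
    have k₄ : π ^ (k + 3) ∣ W.b₄ := pow_dvd_b₄ (one h₁) h₃ h₄ (by omega) (by omega)
    have k₆ : π ^ (2 * k + 4) ∣ W.b₆ := pow_dvd_b₆ h₃ h₆ (by omega) le_rfl
    have k₈ : π ^ (2 * k + 5) ∣ W.b₈ := pow_dvd_b₈ (one h₁) (one h₂) h₃ h₄ h₆
      (by omega) (by omega) (by omega) (by omega) (by omega)
    exact pow_dvd_Δ_of_pow_dvd_b (m := n + 1 + 5 + 1) k₂ k₄ k₆ k₈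
      (by omega) (by omega) (by omega) (by omega)
  | .IStar (n + 1), ⟨h₁, h₂, _, k, .inr ⟨hn, h₃, h₄, h₆, _⟩⟩ =>
    have k₂ : π ^ 1 ∣ W.b₂ := pow_dvd_b₂ (one h₁) (one h₂) (by omega) le_rfl
    have k₄ : π ^ (k + 3) ∣ W.b₄ := pow_dvd_b₄ (one h₁) h₃ h₄ (by omega) (by omega)
    have k₆ : π ^ (2 * k + 5) ∣ W.b₆ := pow_dvd_b₆ h₃ h₆ (by omega) le_rfl
    have k₈ : π ^ (2 * k + 6) ∣ W.b₈ := pow_dvd_b₈ (one h₁) (one h₂) h₃ h₄ h₆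
      (by omega) (by omega) (by omega) (by omega) (by omega)
    exact pow_dvd_Δ_of_pow_dvd_b (m := n + 1 + 5 + 1) k₂ k₄ k₆ k₈
      (by omega) (by omega) (by omega) (by omega)
  | .IVStar, ⟨h₁, h₂, h₃, h₄, h₆, _⟩ =>
    have k₂ : π ^ 2 ∣ W.b₂ := pow_dvd_b₂ (one h₁) h₂ (by omega) le_rfl
    have k₄ : π ^ 3 ∣ W.b₄ := pow_dvd_b₄ (one h₁) h₃ h₄ (by omega) (by omega)
    have k₆ : π ^ 4 ∣ W.b₆ := pow_dvd_b₆ h₃ h₆ (by omega) le_rfl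
    have k₈ : π ^ 4 ∣ W.b₈ := pow_dvd_b₈ (one h₁) h₂ h₃ h₄ h₆
      (by omega) (by omega) (by omega) (by omega) (by omega)
    exact pow_dvd_Δ_of_pow_dvd_b (m := 8) k₂ k₄ k₆ k₈ (by omega) (by omega) (by omega) (by omega)
  | .IIIStar, ⟨h₁, h₂, h₃, h₄, h₆, _⟩ =>
    have k₂ : π ^ 2 ∣ W.b₂ := pow_dvd_b₂ (one h₁) h₂ (by omega) le_rfl
    have k₄ : π ^ 3 ∣ W.b₄ := pow_dvd_b₄ (one h₁) h₃ h₄ (by omega) (by omega)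
    have k₆ : π ^ 5 ∣ W.b₆ := pow_dvd_b₆ h₃ h₆ (by omega) le_rfl
    have k₈ : π ^ 6 ∣ W.b₈ := pow_dvd_b₈ (one h₁) h₂ h₃ h₄ h₆
      (by omega) (by omega) (by omega) (by omega) (by omega)
    exact pow_dvd_Δ_of_pow_dvd_b (m := 9) k₂ k₄ k₆ k₈ (by omega) (by omega) (by omega) (by omega)
  | .IIStar, ⟨h₁, h₂, h₃, h₄, h₆, _⟩ =>
    have k₂ : π ^ 2 ∣ W.b₂ := pow_dvd_b₂ (one h₁) h₂ (by omega) le_rfl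
    have k₄ : π ^ 4 ∣ W.b₄ := pow_dvd_b₄ (one h₁) h₃ h₄ (by omega) (by omega)
    have k₆ : π ^ 5 ∣ W.b₆ := pow_dvd_b₆ h₃ h₆ (by omega) le_rfl
    have k₈ : π ^ 6 ∣ W.b₈ := pow_dvd_b₈ (one h₁) h₂ h₃ h₄ h₆
      (by omega) (by omega) (by omega) (by omega) (by omega)
    exact pow_dvd_Δ_of_pow_dvd_b (m := 10) k₂ k₄ k₆ k₈ (by omega) (by omega) (by omega) (by omega)

end TateForm

end WeierstrassCurve

/-! ### Minimal equations and their invariants -/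

namespace WeierstrassCurve

section Minimal

variable {R : Type*} [CommRing R] {K : Type*} [Field K] [Algebra R K]

theorem isIntegral_baseChange (W : WeierstrassCurve R) : IsIntegral R (W.baseChange K) :=
  ⟨W, rfl⟩

variable [IsFractionRing R K]

theorem invariants_eq_of_variableChange {W W' : WeierstrassCurve R} {C : VariableChange K}
    (h : C • W.baseChange K = W'.baseChange K) {v : R} (hv : algebraMap R K v = C.u) :
    W.Δ = v ^ 12 * W'.Δ ∧ W.c₄ = v ^ 4 * W'.c₄ ∧ W.c₆ = v ^ 6 * W'.c₆ := by
  have inj := IsFractionRing.injective R K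
  have hu : (C.u : K) * (C.u⁻¹ : Kˣ) = 1 := C.u.mul_inv
  have h12 := congrArg WeierstrassCurve.Δ h
  have h4 := congrArg WeierstrassCurve.c₄ h
  have h6 := congrArg WeierstrassCurve.c₆ h
  simp only [variableChange_Δ, variableChange_c₄, variableChange_c₆, baseChange, map_Δ, map_c₄,
    map_c₆] at h12 h4 h6
  refine ⟨inj ?_, inj ?_, inj ?_⟩ <;> rw [map_mul, map_pow, hv]
  · rw [← h12, ← mul_assoc, ← mul_pow, hu, one_pow, one_mul]
  · rw [← h4, ← mul_assoc, ← mul_pow, hu, one_pow, one_mul]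
  · rw [← h6, ← mul_assoc, ← mul_pow, hu, one_pow, one_mul]

variable [IsDomain R] [IsDiscreteValuationRing R]

open IsDiscreteValuationRing IsDedekindDomain.HeightOneSpectrum

/-- The change scales Δ by u⁻¹², and minimality forbids the multiplicative valuation of Δ to grow.
Applied in both directions, this makes u a unit. -/
theorem valuation_u_le_one_of_isMinimal {W W' : WeierstrassCurve R} {C : VariableChange K}
    (h : C • W.baseChange K = W'.baseChange K) (hW : IsMinimal R (W.baseChange K)) (hΔ : W.Δ ≠ 0) :
    valuation K (maximalIdeal R) (C.u⁻¹ : Kˣ) ≤ 1 := by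
  have i1 : IsIntegral R (W.baseChange K) := isIntegral_baseChange W
  have i2 : IsIntegral R (C • W.baseChange K) := h ▸ isIntegral_baseChange W'
  have hm := hW.val_Δ_maximal
  have i3 : IsIntegral R ((1 : VariableChange K) • W.baseChange K) := by rwa [one_smul]
  have key : valuation K (maximalIdeal R) (C • W.baseChange K).Δ
      ≤ valuation K (maximalIdeal R) (W.baseChange K).Δ := by
    rcases le_total (valuation_Δ_aux R ((1 : VariableChange K) • W.baseChange K))
      (valuation_Δ_aux R (C • W.baseChange K)) with hle | hle
    · have := hm.2 i2 hle
      rw [← Subtype.coe_le_coe, valuation_Δ_aux_eq_of_isIntegral,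
        valuation_Δ_aux_eq_of_isIntegral] at this
      simpa using this
    · rw [← Subtype.coe_le_coe, valuation_Δ_aux_eq_of_isIntegral,
        valuation_Δ_aux_eq_of_isIntegral] at hle
      simpa using hle
  rw [variableChange_Δ, map_mul, map_pow] at key
  have hne : valuation K (maximalIdeal R) (W.baseChange K).Δ ≠ 0 := by
    rw [baseChange, map_Δ]
    simpa using hΔ
  by_contra! hlt
  have := one_lt_pow₀ hlt (n := 12) (by norm_num)
  have h2 := (mul_lt_mul_iff_left₀ (zero_lt_iff.2 hne)).2 this
  rw [one_mul] at h2
  exact absurd key (not_le.2 h2)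

/-- Two isomorphic minimal equations differ by a unit scaling of the invariants. -/
theorem exists_unit_of_isMinimal {W W' : WeierstrassCurve R} {C : VariableChange K}
    (h : C • W.baseChange K = W'.baseChange K) (hW : IsMinimal R (W.baseChange K))
    (hW' : IsMinimal R (W'.baseChange K)) (hΔ : W.Δ ≠ 0) :
    ∃ v : Rˣ, W.Δ = v ^ 12 * W'.Δ ∧ W.c₄ = v ^ 4 * W'.c₄ ∧ W.c₆ = v ^ 6 * W'.c₆ := by
  have h' : C⁻¹ • W'.baseChange K = W.baseChange K := by rw [← h, inv_smul_smul]
  have hΔ' : W'.Δ ≠ 0 := by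
    intro h0
    have h12 := congrArg WeierstrassCurve.Δ h'
    simp only [variableChange_Δ, baseChange, map_Δ, h0, map_zero, mul_zero] at h12
    exact hΔ ((IsFractionRing.injective R K) (by rw [← h12, map_zero]))
  have h1 := valuation_u_le_one_of_isMinimal h hW hΔ
  have h2 := valuation_u_le_one_of_isMinimal h' hW' hΔ'
  obtain ⟨w, hw⟩ := exists_lift_of_le_one h1
  obtain ⟨v, hv⟩ := exists_lift_of_le_one h2
  have hv' : algebraMap R K v = C.u := by
    rw [hv]; simp [VariableChange.inv_def]
  have hvw : v * w = 1 := by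
    apply IsFractionRing.injective R K
    rw [map_mul, map_one, hv', hw]
    exact C.u.mul_inv
  exact ⟨Units.mkOfMulEqOne v w hvw, invariants_eq_of_variableChange h hv'⟩

/-- A strictly better integral equation comes from a scaling u = πw with w integral, so minimality
can be tested on the invariants alone. -/
theorem isMinimal_baseChange_of_forall {π : R} (hπ : Irreducible π) {W : WeierstrassCurve R}
    (h : ∀ (W' : WeierstrassCurve R) (w : R), W.Δ = (π * w) ^ 12 * W'.Δ →
      W.c₄ = (π * w) ^ 4 * W'.c₄ → W.c₆ ≠ (π * w) ^ 6 * W'.c₆) :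
    IsMinimal R (W.baseChange K) := by
  have i1 : IsIntegral R (W.baseChange K) := isIntegral_baseChange W
  have i3 : IsIntegral R ((1 : VariableChange K) • W.baseChange K) := by rwa [one_smul]
  refine ⟨⟨i3, fun C hC _ => ?_⟩⟩
  obtain ⟨W', hW'⟩ := hC.integral
  have i2 : IsIntegral R (C • W.baseChange K) := hC
  rw [← Subtype.coe_le_coe, valuation_Δ_aux_eq_of_isIntegral, valuation_Δ_aux_eq_of_isIntegral,
    one_smul, variableChange_Δ, map_mul, map_pow]
  suffices hle : valuation K (maximalIdeal R) (C.u⁻¹ : Kˣ) ≤ 1 by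
    exact mul_le_of_le_one_left' (pow_le_one' hle 12)
  by_contra! hlt
  have hlt' : valuation K (maximalIdeal R) (C.u : K) < 1 := by
    rw [Units.val_inv_eq_inv_val, map_inv₀] at hlt
    exact (one_lt_inv₀ (zero_lt_iff.2 (by simp))).1 hlt
  obtain ⟨v, hv⟩ := exists_lift_of_le_one hlt'.le
  rw [← hv] at hlt'
  have hvm : v ∈ IsLocalRing.maximalIdeal R := (valuation_lt_one_iff_mem _ _).1 hlt'
  rw [hπ.maximalIdeal_eq, Ideal.mem_span_singleton] at hvm
  obtain ⟨w, rfl⟩ := hvm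
  obtain ⟨e1, e2, e3⟩ := invariants_eq_of_variableChange hW' hv
  exact h W' w e1 e2 e3

theorem isMinimal_baseChange_of_not_dvd_Δ {π : R} (hπ : Irreducible π) {W : WeierstrassCurve R}
    (h : ¬ π ^ 12 ∣ W.Δ) : IsMinimal R (W.baseChange K) :=
  isMinimal_baseChange_of_forall hπ fun W' w e _ _ => h <| by
    rw [e, mul_pow, mul_assoc]; exact dvd_mul_right _ _

theorem isMinimal_baseChange_of_not_dvd_c₄ {π : R} (hπ : Irreducible π) {W : WeierstrassCurve R}
    (h : ¬ π ^ 4 ∣ W.c₄) : IsMinimal R (W.baseChange K) :=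
  isMinimal_baseChange_of_forall hπ fun W' w _ e _ => h <| by
    rw [e, mul_pow, mul_assoc]; exact dvd_mul_right _ _

end Minimal

/-! ### The conductor exponent as an attained infimum -/

section TateModel

variable {E : WeierstrassCurve ℚ} {p : ℕ} [Fact p.Prime] {W W₀ : WeierstrassCurve ℤ_[p]}
  {T T₀ : KodairaSymbol}

theorem IsTateModel.exists_unit (h : IsTateModel E p W T) (h₀ : IsTateModel E p W₀ T₀)
    (hΔ : W₀.Δ ≠ 0) :
    ∃ v : ℤ_[p]ˣ, W₀.Δ = v ^ 12 * W.Δ ∧ W₀.c₄ = v ^ 4 * W.c₄ ∧ W₀.c₆ = v ^ 6 * W.c₆ := by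
  obtain ⟨⟨C, hC⟩, hm, -⟩ := h
  obtain ⟨⟨C₀, hC₀⟩, hm₀, -⟩ := h₀
  refine exists_unit_of_isMinimal (K := ℚ_[p]) (C := C * C₀⁻¹) ?_ hm₀ hm hΔ
  rw [← hC, ← hC₀, mul_smul, inv_smul_smul]

theorem le_valuation_of_pow_dvd {x : ℤ_[p]} (hx : x ≠ 0) {n : ℕ} (h : (p : ℤ_[p]) ^ n ∣ x) :
    n ≤ x.valuation := by
  rwa [← PadicInt.mem_span_pow_iff_le_valuation x hx, Ideal.mem_span_singleton]

/-- An infimum in ℕ is attained once the set is nonempty. For `W₀` to contribute, v(Δ) + 1 - m must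
not be truncated, which is where the bound on Δ enters. -/
theorem exists_isTateModel_conductorExponent (h₀ : IsTateModel E p W₀ T₀) (hc : (p : ℤ_[p]) ∣ W₀.c₄)
    (hΔ : (p : ℤ_[p]) ∣ W₀.Δ) (hΔ₀ : W₀.Δ ≠ 0) :
    ∃ W T, IsTateModel E p W T ∧ E.conductorExponent p + T.numComponents = W.Δ.valuation + 1 := by
  have hmem := Nat.sInf_mem (s := {f : ℕ | ∃ (W : WeierstrassCurve ℤ_[p]) (T : KodairaSymbol),
    IsTateModel E p W T ∧ f + T.numComponents = W.Δ.valuation + 1})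
    ⟨W₀.Δ.valuation + 1 - T₀.numComponents, W₀, T₀, h₀, by
      have := le_valuation_of_pow_dvd hΔ₀ (h₀.2.2.pow_numComponents_add_one_dvd_Δ hc hΔ)
      omega⟩
  exact hmem

/-- The models that compute the conductor exponent in the case of additive reduction. -/
theorem exists_isTateModel_of_additive (h₀ : IsTateModel E p W₀ T₀) (hc : (p : ℤ_[p]) ∣ W₀.c₄)
    (hΔ : (p : ℤ_[p]) ∣ W₀.Δ) (hΔ₀ : W₀.Δ ≠ 0) :
    ∃ (W : WeierstrassCurve ℤ_[p]) (T : KodairaSymbol) (v : ℤ_[p]ˣ),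
      IsTateForm (p : ℤ_[p]) W T ∧
      E.conductorExponent p + T.numComponents = W.Δ.valuation + 1 ∧ 2 ≤ E.conductorExponent p ∧
      W.Δ = v ^ 12 * W₀.Δ ∧ W.c₄ = v ^ 4 * W₀.c₄ ∧ W.c₆ = v ^ 6 * W₀.c₆ := by
  obtain ⟨W, T, h, hf⟩ := exists_isTateModel_conductorExponent h₀ hc hΔ hΔ₀
  obtain ⟨v, e1, e2, e3⟩ := h.exists_unit h₀ hΔ₀
  have e1' : W.Δ = (v⁻¹ : ℤ_[p]ˣ) ^ 12 * W₀.Δ := by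
    rw [e1, ← mul_assoc, ← mul_pow, Units.inv_mul, one_pow, one_mul]
  have e2' : W.c₄ = (v⁻¹ : ℤ_[p]ˣ) ^ 4 * W₀.c₄ := by
    rw [e2, ← mul_assoc, ← mul_pow, Units.inv_mul, one_pow, one_mul]
  have e3' : W.c₆ = (v⁻¹ : ℤ_[p]ˣ) ^ 6 * W₀.c₆ := by
    rw [e3, ← mul_assoc, ← mul_pow, Units.inv_mul, one_pow, one_mul]
  refine ⟨W, T, v⁻¹, h.2.2, hf, ?_, e1', e2', e3'⟩
  have hne : W.Δ ≠ 0 := by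
    rintro h0
    rw [h0, mul_zero] at e1
    exact hΔ₀ e1
  have := le_valuation_of_pow_dvd hne (h.2.2.pow_numComponents_add_one_dvd_Δ
    (e2' ▸ hc.mul_left _) (e1' ▸ hΔ.mul_left _))
  omega

theorem conductorExponent_eq_zero (h : IsTateModel E p W (.I 0)) : E.conductorExponent p = 0 := by
  refine Nat.sInf_eq_zero.2 (.inl ⟨W, .I 0, h, ?_⟩)
  have h1 : ¬ (p : ℤ_[p]) ∣ W.Δ := h.2.2
  have h0 : W.Δ ≠ 0 := fun h0 => h1 (h0 ▸ dvd_zero _)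
  have : ¬ 1 ≤ W.Δ.valuation := by
    rwa [← PadicInt.mem_span_pow_iff_le_valuation _ h0, Ideal.mem_span_singleton, pow_one]
  simp only [KodairaSymbol.numComponents]
  omega

end TateModel

end WeierstrassCurve

/-! ### Exact divisibility; parity and squares in the 2-adic integers -/

theorem not_pow_succ_dvd_pow_mul {R : Type*} [CommRing R] [IsDomain R] {π x : R} (hπ : π ≠ 0)
    (hx : ¬ π ∣ x) (n : ℕ) : ¬ π ^ (n + 1) ∣ π ^ n * x := by
  rwa [pow_succ, mul_dvd_mul_iff_left (pow_ne_zero n hπ)]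

namespace PadicInt

theorem prime_two : Prime (2 : ℤ_[2]) := by
  simpa using PadicInt.prime_p (p := 2)

theorem odd_iff_not_two_dvd {x : ℤ_[2]} : Odd x ↔ ¬ 2 ∣ x := by
  constructor
  · rintro ⟨y, rfl⟩ h
    exact prime_two.not_dvd_one ((dvd_add_right (dvd_mul_right 2 y)).1 h)
  · intro h
    obtain ⟨n, hn, hx⟩ := PadicInt.exists_mem_range x
    rw [PadicInt.maximalIdeal_eq_span_p, Ideal.mem_span_singleton, Nat.cast_ofNat] at hx
    obtain ⟨y, hy⟩ := hx
    interval_cases n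
    · exact absurd ⟨y, by simpa using hy⟩ h
    · exact ⟨y, by rw [← hy]; simp⟩

theorem even_or_odd (x : ℤ_[2]) : Even x ∨ Odd x := by
  rw [even_iff_two_dvd, odd_iff_not_two_dvd]
  exact em _

theorem not_two_pow_succ_dvd {x : ℤ_[2]} (hx : Odd x) (n : ℕ) : ¬ 2 ^ (n + 1) ∣ 2 ^ n * x :=
  not_pow_succ_dvd_pow_mul prime_two.ne_zero (odd_iff_not_two_dvd.1 hx) n

theorem odd_unit (v : ℤ_[2]ˣ) : Odd (v : ℤ_[2]) :=
  odd_iff_not_two_dvd.2 fun h => prime_two.not_isUnit (isUnit_of_dvd_unit h v.isUnit)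

theorem valuation_two_pow_mul {x : ℤ_[2]} (hx : Odd x) (n : ℕ) : (2 ^ n * x).valuation = n := by
  have h0 : x ≠ 0 := by
    rintro rfl
    exact odd_iff_not_two_dvd.1 hx (dvd_zero _)
  have h := PadicInt.valuation_p_pow_mul (p := 2) n x h0
  have hv : ¬ 1 ≤ x.valuation := by
    rw [← PadicInt.mem_span_pow_iff_le_valuation _ h0, Ideal.mem_span_singleton, pow_one]
    exact odd_iff_not_two_dvd.1 hx
  rw [Nat.cast_ofNat] at h
  omega

theorem even_valuation_of_isSquare {p : ℕ} [Fact p.Prime] {x : ℤ_[p]} (h : IsSquare x) :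
    Even x.valuation := by
  obtain ⟨z, rfl⟩ := h
  rw [← pow_two, PadicInt.valuation_pow]
  exact even_two_mul _

/-- Integral closedness removes the even power of 2, and squares are 0 or 1 mod 4. -/
theorem not_isSquare_two_pow_mul {y : ℤ_[2]} (hy : 4 ∣ y - 3) (n : ℕ) :
    ¬ IsSquare (2 ^ (2 * n) * y) := by
  rintro ⟨z, hz⟩
  have hd : (2 ^ n) ^ 2 ∣ z ^ 2 := ⟨y, by rw [pow_two z, ← hz]; ring⟩
  rw [IsIntegrallyClosed.pow_dvd_pow_iff two_ne_zero] at hd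
  obtain ⟨w, rfl⟩ := hd
  have hw : y = w ^ 2 := by
    apply mul_left_cancel₀ (pow_ne_zero (2 * n) prime_two.ne_zero)
    rw [hz]; ring
  obtain ⟨q, hq⟩ := hy
  rcases even_or_odd w with ⟨u, rfl⟩ | ⟨u, rfl⟩
  · refine odd_iff_not_two_dvd.1 (⟨1, by ring⟩ : Odd (3 : ℤ_[2])) ⟨2 * u ^ 2 - 2 * q, ?_⟩
    linear_combination -hq + hw
  · refine odd_iff_not_two_dvd.1 (⟨0, by ring⟩ : Odd (1 : ℤ_[2])) ⟨u ^ 2 + u - q, ?_⟩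
    refine mul_left_cancel₀ prime_two.ne_zero ?_
    linear_combination -hq + hw

end PadicInt

/-! ### Tate forms at 2 with square discriminant -/

namespace WeierstrassCurve

open PadicInt

variable {W : WeierstrassCurve ℤ_[2]}

/-- The alternatives are 4 ∣ a₁, making b₂ divisible by 16, and a₁/2 odd, making b₂/4 ≡ 1 mod 4, so
that -b₂³ fixes c₆/64 mod 4. -/
theorem IsTateForm.c₄_or_c₆_of_IIIStar (h : W.IsTateForm 2 .IIIStar) :
    2 ^ 7 ∣ W.c₄ ∨ ∃ y, W.c₆ = 64 * y ∧ 4 ∣ y + 1 := by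
  obtain ⟨⟨a, h₁⟩, ⟨b, h₂⟩, ⟨c, h₃⟩, ⟨d, h₄⟩, ⟨e, h₆⟩, -⟩ := h
  rcases even_or_odd a with ⟨k, rfl⟩ | ⟨k, rfl⟩
  · refine .inl ⟨2 * (k ^ 2 + b) ^ 2 - 3 * (2 * k * c + d), ?_⟩
    rw [c₄, b₂, b₄, h₁, h₂, h₃, h₄]; ring
  · refine .inr ⟨-((2 * k + 1) ^ 2 + 4 * b) ^ 3
      + 36 * ((2 * k + 1) ^ 2 + 4 * b) * ((2 * k + 1) * c + d) - 216 * (c ^ 2 + 2 * e), ?_,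
      -(3 * (k ^ 2 + k + b) + 12 * (k ^ 2 + k + b) ^ 2 + 16 * (k ^ 2 + k + b) ^ 3)
      + 9 * ((2 * k + 1) ^ 2 + 4 * b) * ((2 * k + 1) * c + d) - 54 * (c ^ 2 + 2 * e), ?_⟩
    · rw [c₆, b₂, b₄, b₆, h₁, h₂, h₃, h₄, h₆]; ring
    · ring

/-- For j = 0 the term -27b₆² dominates Δ and has valuation 8. For j ≥ 1, Δ has odd valuation, or is
2¹² times a number that is 3 mod 4, so it is not a square. -/
theorem IsTateForm.invariants_of_IStar_odd {j : ℕ} (h : W.IsTateForm 2 (.IStar (2 * j + 1)))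
    (hsq : IsSquare W.Δ) :
    (∃ x, Odd x ∧ W.Δ = 2 ^ 8 * x) ∧ (2 ^ 6 ∣ W.c₄ ∨ ∃ y, W.c₆ = 64 * y ∧ 4 ∣ y - 1) := by
  obtain ⟨⟨a, h₁⟩, ⟨b, h₂⟩, hb, k, hk⟩ := h
  obtain ⟨hk, ⟨c, h₃⟩, ⟨d, h₄⟩, ⟨e, h₆⟩, hc⟩ : 2 * j = 2 * k ∧ 2 ^ (k + 2) ∣ W.a₃ ∧
      2 ^ (k + 3) ∣ W.a₄ ∧ 2 ^ (2 * k + 4) ∣ W.a₆ ∧ ¬ 2 ^ (2 * k + 5) ∣ W.b₆ := by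
    rcases hk with hk | hk
    · exact hk
    · have := hk.1
      omega
  obtain rfl : j = k := by omega
  replace hb : Odd b := by
    rw [odd_iff_not_two_dvd]
    rintro ⟨x, rfl⟩
    exact hb ⟨x, by rw [h₂]; ring⟩
  have e₂ : W.b₂ = 4 * (a ^ 2 + 2 * b) := by rw [b₂, h₁, h₂]; ring
  have e₄ : W.b₄ = 2 ^ (j + 3) * (a * c + 2 * d) := by rw [b₄, h₁, h₃, h₄]; ring
  have e₆ : W.b₆ = 2 ^ (2 * j + 4) * (c ^ 2 + 4 * e) := by rw [b₆, h₃, h₆]; ring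
  have e₈ : W.b₈ = 2 ^ (2 * j + 5) *
      (b * c ^ 2 + 2 * (a ^ 2 * e + 2 * b * e - a * c * d - d ^ 2)) := by
    rw [b₈, h₁, h₂, h₃, h₄, h₆]; ring
  have hq : Odd (c ^ 2 + 4 * e) := by
    rw [odd_iff_not_two_dvd]
    rintro ⟨x, hx⟩
    exact hc ⟨x, by rw [e₆, hx]; ring⟩
  replace hc : Odd c := by
    rcases even_or_odd c with ⟨x, rfl⟩ | hc
    · exact absurd ⟨2 * x ^ 2 + 2 * e, by ring⟩ (odd_iff_not_two_dvd.1 hq)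
    · exact hc
  have hg : Odd (b * c ^ 2 + 2 * (a ^ 2 * e + 2 * b * e - a * c * d - d ^ 2)) :=
    (hb.mul hc.pow).add_even (even_two_mul _)
  generalize a ^ 2 * e + 2 * b * e - a * c * d - d ^ 2 = g at *
  generalize hP : b * c ^ 2 + 2 * g = P at *
  have not_odd {n : ℕ} {x : ℤ_[2]} (hx : Odd x) : W.Δ ≠ 2 ^ (2 * n + 1) * x := by
    intro hΔ
    have := even_valuation_of_isSquare hsq
    rw [hΔ, valuation_two_pow_mul hx] at this
    exact absurd this (by simp)
  rcases j with _ | j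
  · refine ⟨⟨-(27 * (c ^ 2 + 4 * e) ^ 2) + 2 * (-((a ^ 2 + 2 * b) ^ 2 * P)
      - 8 * (a * c + 2 * d) ^ 3 + 9 * (a ^ 2 + 2 * b) * (a * c + 2 * d) * (c ^ 2 + 4 * e)),
      ?_, ?_⟩, ?_⟩
    · exact (Odd.mul ⟨13, by ring⟩ hq.pow).neg.add_even (even_two_mul _)
    · rw [Δ, e₂, e₄, e₆, e₈]; ring
    · rcases even_or_odd a with ⟨k, rfl⟩ | ha
      · refine .inl ⟨(2 * k ^ 2 + b) ^ 2 - 6 * (k * c + d), ?_⟩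
        rw [c₄, e₂, e₄]; ring
      · obtain ⟨v, hv⟩ : Odd (a * c + 2 * d) := (ha.mul hc).add_even (even_two_mul _)
        obtain ⟨q, hq⟩ := hq
        obtain ⟨k, rfl⟩ := ha
        obtain ⟨l, rfl⟩ := hb
        have hU : (2 * k + 1) ^ 2 + 2 * (2 * l + 1) = 4 * (k ^ 2 + k + l) + 3 := by ring
        rw [hU] at e₂
        rw [hv] at e₄
        rw [hq] at e₆
        generalize k ^ 2 + k + l = m at e₂
        refine .inr ⟨-(4 * m + 3) ^ 3 + 18 * (4 * m + 3) * (2 * v + 1) - 54 * (2 * q + 1), ?_,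
          -(16 * m ^ 3 + 36 * m ^ 2 + 27 * m) + 18 * (2 * m * v + m) + 27 * v - 27 * q - 7, ?_⟩
        · rw [c₆, e₂, e₄, e₆]; ring
        · ring
  · exfalso
    -- The parity of a = a₁/2 decides v(b₂), which is 3 or 2. The term b₂²b₈ of odd valuation
    -- dominates, except when `a` is even and the symbol is I₃*: there b₆² has valuation 12 against
    -- 13, and Δ/2¹² must be read mod 4.
    rcases even_or_odd a with ⟨k, rfl⟩ | ha
    · have hU : Odd (2 * k ^ 2 + b) := by
        rw [add_comm]; exact hb.add_even (even_two_mul _)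
      have e₂' : W.b₂ = 8 * (2 * k ^ 2 + b) := by rw [e₂]; ring
      have e₄' : W.b₄ = 2 ^ (j + 5) * (k * c + d) := by rw [e₄]; ring
      rcases j with _ | j
      · obtain ⟨r, hr⟩ : Odd ((2 * k ^ 2 + b) ^ 2 * P) := hU.pow.mul hg
        obtain ⟨q, hq⟩ := hq
        rw [hq] at e₆
        refine not_isSquare_two_pow_mul (n := 6) (y := -(2 * (2 * r + 1)) - 64 * (k * c + d) ^ 3
          - 27 * (2 * q + 1) ^ 2 + 36 * (2 * k ^ 2 + b) * (k * c + d) * (2 * q + 1)) ?_ ?_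
        · refine ⟨-r - 16 * (k * c + d) ^ 3 - 27 * (q ^ 2 + q)
            + 9 * (2 * k ^ 2 + b) * (k * c + d) * (2 * q + 1) - 8, ?_⟩
          ring
        · rw [← hr]
          convert hsq using 1
          rw [Δ, e₂', e₄', e₆, e₈]; ring
      · refine not_odd (n := j + 7) (x := -((2 * k ^ 2 + b) ^ 2 * P)
          + 2 * (-(2 ^ (j + 5) * (k * c + d) ^ 3) - 27 * 2 ^ (2 * j) * (c ^ 2 + 4 * e) ^ 2
          + 9 * 2 ^ (j + 1) * (2 * k ^ 2 + b) * (k * c + d) * (c ^ 2 + 4 * e))) ?_ ?_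
        · exact (hU.pow.mul hg).neg.add_even (even_two_mul _)
        · rw [Δ, e₂', e₄', e₆, e₈]; ring
    · have hU : Odd (a ^ 2 + 2 * b) := ha.pow.add_even (even_two_mul _)
      refine not_odd (n := j + 5) (x := -((a ^ 2 + 2 * b) ^ 2 * P)
        + 2 * (-(2 ^ (j + 3) * (a * c + 2 * d) ^ 3) - 27 * 2 ^ (2 * j) * (c ^ 2 + 4 * e) ^ 2
        + 9 * 2 ^ j * (a ^ 2 + 2 * b) * (a * c + 2 * d) * (c ^ 2 + 4 * e))) ?_ ?_
      · exact (hU.pow.mul hg).neg.add_even (even_two_mul _)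
      · rw [Δ, e₂, e₄, e₆, e₈]; ring

/-- Constraints on the invariants of a Tate form at `2` with square discriminant whose conductor
exponent is `3` or `5`. -/
theorem IsTateForm.invariants_of_odd_conductorExponent {T : KodairaSymbol} (h : W.IsTateForm 2 T)
    (hc : 2 ∣ W.c₄) (hΔ : 2 ^ 8 ∣ W.Δ) (hΔ₀ : W.Δ ≠ 0) (hsq : IsSquare W.Δ) {f : ℕ} (hf : Odd f)
    (hf5 : f ≤ 5) (hT : f + T.numComponents = W.Δ.valuation + 1) :
    (¬ 2 ^ 9 ∣ W.Δ ∧ (2 ^ 6 ∣ W.c₄ ∨ ∃ y, W.c₆ = 64 * y ∧ 4 ∣ y - 1)) ∨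
      (2 ^ 9 ∣ W.Δ ∧ (2 ^ 7 ∣ W.c₄ ∨ ∃ y, W.c₆ = 64 * y ∧ 4 ∣ y + 1)) := by
  have hv : 8 ≤ W.Δ.valuation := le_valuation_of_pow_dvd (p := 2) hΔ₀ (by simpa using hΔ)
  obtain ⟨v, hv2⟩ := even_valuation_of_isSquare hsq
  obtain ⟨g, rfl⟩ := hf
  -- v(Δ) is even and f odd, so the number of components is even, and at least 8 + 1 - 5 = 4. This
  -- leaves III* and Iₙ* with n odd.
  match T, h with
  | .I 0, h => exact absurd ((dvd_pow_self 2 (by norm_num)).trans hΔ) h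
  | .I (n + 1), h => exact absurd hc h.1
  | .II, _ => simp only [KodairaSymbol.numComponents] at hT; omega
  | .III, _ => simp only [KodairaSymbol.numComponents] at hT; omega
  | .IV, _ => simp only [KodairaSymbol.numComponents] at hT; omega
  | .IVStar, _ => simp only [KodairaSymbol.numComponents] at hT; omega
  | .IIStar, _ => simp only [KodairaSymbol.numComponents] at hT; omega
  | .IIIStar, h =>
    exact .inr ⟨h.pow_numComponents_add_one_dvd_Δ hc ((dvd_pow_self 2 (by norm_num)).trans hΔ),
      h.c₄_or_c₆_of_IIIStar⟩
  | .IStar n, h =>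
    obtain ⟨j, rfl⟩ : ∃ j, n = 2 * j + 1 := ⟨(n - 1) / 2, by
      simp only [KodairaSymbol.numComponents] at hT; omega⟩
    obtain ⟨⟨x, hx, hΔx⟩, h'⟩ := h.invariants_of_IStar_odd hsq
    exact .inl ⟨hΔx ▸ not_two_pow_succ_dvd hx 8, h'⟩

end WeierstrassCurve

/-! ### The model Y² = X(X - a)(X + b) and its ramified twists at odd primes -/

namespace WeierstrassCurve

/-- The Weierstrass equation `Y² = X (X - a) (X + b)` over a commutative ring. -/
def twoTorsionModel {R : Type*} [CommRing R] (a b : R) : WeierstrassCurve R where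
  a₁ := 0
  a₂ := b - a
  a₃ := 0
  a₄ := -(a * b)
  a₆ := 0

section TwoTorsionModel

variable {R : Type*} [CommRing R] (a b : R)

theorem twoTorsionModel_c₄ : (twoTorsionModel a b).c₄ = 16 * (a ^ 2 + a * b + b ^ 2) := by
  simp only [c₄, b₂, b₄, twoTorsionModel]; ring

theorem twoTorsionModel_c₆ :
    (twoTorsionModel a b).c₆ = -32 * (b - a) * (2 * (b - a) ^ 2 + 9 * (a * b)) := by
  simp only [c₆, b₂, b₄, b₆, twoTorsionModel]; ring

theorem twoTorsionModel_Δ : (twoTorsionModel a b).Δ = (4 * (a * b * (a + b))) ^ 2 := by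
  simp only [Δ, b₂, b₄, b₆, b₈, twoTorsionModel]; ring

theorem map_twoTorsionModel {S : Type*} [CommRing S] (φ : R →+* S) :
    (twoTorsionModel a b).map φ = twoTorsionModel (φ a) (φ b) := by
  ext <;> simp [twoTorsionModel]

variable {a b}

theorem isTateForm_twoTorsionModel_IStar_zero [IsDomain R] {π δ : R} (hπ : Prime π) (hδ : ¬ π ∣ δ)
    (h : ¬ π ∣ a * b * (a + b)) :
    (twoTorsionModel (π * (δ * a)) (π * (δ * b))).IsTateForm π (.IStar 0) := by
  refine ⟨dvd_zero _, ⟨δ * (b - a), ?_⟩, dvd_zero _, ⟨-(δ ^ 2 * (a * b)), ?_⟩, dvd_zero _, ?_⟩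
  · simp only [twoTorsionModel]; ring
  · simp only [twoTorsionModel]; ring
  · convert not_pow_succ_dvd_pow_mul hπ.ne_zero (x := (δ ^ 3 * (a * b * (a + b))) ^ 2) ?_ 6 using 2
    · simp only [twoTorsionModel]; ring
    · exact fun hd => (hπ.dvd_or_dvd (hπ.dvd_of_dvd_pow hd)).elim
        (fun hd => hδ (hπ.dvd_of_dvd_pow hd)) h

/-- As a₆ = 0, the discriminant of the final quadratic is a square, with no factor 2 or 4 involved.
The lemma therefore serves the odd primes and the prime 2 alike. -/
theorem isTateForm_twoTorsionModel_IStar_even [IsDomain R] {π δ : R} (hπ : Prime π)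
    (hδ : ¬ π ∣ δ) (ha : ¬ π ∣ a) (hb : ¬ π ∣ b) (k : ℕ) :
    (twoTorsionModel (π * (δ * a)) (π * (δ * (π ^ (k + 1) * b)))).IsTateForm π
      (.IStar (2 * k + 1 + 1)) := by
  refine ⟨dvd_zero _, ⟨δ * (π ^ (k + 1) * b - a), ?_⟩, ?_, k, .inr ⟨rfl, dvd_zero _,
    ⟨-(δ ^ 2 * (a * b)), ?_⟩, dvd_zero _, ?_⟩⟩
  · simp only [twoTorsionModel]; ring
  · convert not_pow_succ_dvd_pow_mul hπ.ne_zero (x := δ * (π ^ (k + 1) * b - a)) ?_ 1 using 2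
    · simp only [twoTorsionModel]; ring
    · refine fun hd => (hπ.dvd_or_dvd hd).elim hδ fun hd => ha ?_
      refine (dvd_sub_right ?_).1 hd
      exact (dvd_pow_self π (by omega)).mul_right _
  · simp only [twoTorsionModel]; ring
  · convert not_pow_succ_dvd_pow_mul hπ.ne_zero (x := (δ ^ 2 * (a * b)) ^ 2) ?_ (2 * k + 6) using 2
    · simp only [twoTorsionModel]; ring
    · exact fun hd => (hπ.dvd_or_dvd (hπ.dvd_of_dvd_pow hd)).elim
        (fun hd => hδ (hπ.dvd_of_dvd_pow hd)) fun hd => (hπ.dvd_or_dvd hd).elim ha hb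

end TwoTorsionModel

theorem exists_variableChange_baseChange {E : WeierstrassCurve ℚ} {C : VariableChange ℚ} {a b : ℤ}
    (hE : C • E = twoTorsionModel (a : ℚ) (b : ℚ)) (p : ℕ) [Fact p.Prime]
    (D : VariableChange ℤ_[p]) :
    ∃ C' : VariableChange ℚ_[p], C' • E.baseChange ℚ_[p] =
      (D • twoTorsionModel (a : ℤ_[p]) (b : ℤ_[p])).baseChange ℚ_[p] := by
  refine ⟨D.map (algebraMap ℤ_[p] ℚ_[p]) * C.map (algebraMap ℚ ℚ_[p]), ?_⟩
  rw [baseChange, baseChange, mul_smul, map_variableChange, hE, ← map_variableChange,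
    map_twoTorsionModel, map_twoTorsionModel]
  simp

theorem natCast_dvd_intCast_padicInt_iff {p : ℕ} [Fact p.Prime] {x : ℤ} :
    (p : ℤ_[p]) ∣ (x : ℤ_[p]) ↔ (p : ℤ) ∣ x := by
  simpa using PadicInt.pow_p_dvd_int_iff (p := p) 1 x

theorem exists_eq_pow_succ_mul {p : ℕ} [hp : Fact p.Prime] {x : ℤ} (hx : x ≠ 0) (h : (p : ℤ) ∣ x) :
    ∃ (k : ℕ) (y : ℤ), x = (p : ℤ) ^ (k + 1) * y ∧ ¬ (p : ℤ) ∣ y := by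
  have hf : FiniteMultiplicity (p : ℤ) x :=
    Int.finiteMultiplicity_iff.2 ⟨by simpa using hp.out.ne_one, hx⟩
  obtain ⟨y, hy, hd⟩ := hf.exists_eq_pow_mul_and_not_dvd
  rcases hm : multiplicity (p : ℤ) x with _ | k
  · rw [hm, pow_zero, one_mul] at hy
    exact absurd (hy ▸ h) hd
  · exact ⟨k, y, hm ▸ hy, hd⟩

/-- Ramified quadratic twists of curves with full `2`-torsion that are semistable at the odd prime
`p` have additive reduction at `p`. -/
theorem two_le_conductorExponent {E : WeierstrassCurve ℚ} {C : VariableChange ℚ} {p : ℕ}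
    [hp : Fact p.Prime] (hp2 : p ≠ 2) {δ A B : ℤ}
    (hE : C • E = twoTorsionModel ((p * (δ * A) : ℤ) : ℚ) ((p * (δ * B) : ℤ) : ℚ))
    (hAB : IsCoprime A B) (hδ : ¬ (p : ℤ) ∣ δ) (h0 : A * B * (A + B) ≠ 0)
    (h : (p : ℤ) ∣ B ∨ ¬ (p : ℤ) ∣ A * B * (A + B)) : 2 ≤ E.conductorExponent p := by
  have hprime := PadicInt.prime_p (p := p)
  have hδ' : ¬ (p : ℤ_[p]) ∣ (δ : ℤ_[p]) := mt natCast_dvd_intCast_padicInt_iff.1 hδ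
  have hδ0 : δ ≠ 0 := by rintro rfl; exact hδ (dvd_zero _)
  have h2 : ¬ (p : ℤ_[p]) ∣ 2 := by
    have := mt (natCast_dvd_intCast_padicInt_iff (p := p) (x := 2)).1 (fun hd => hp2
      ((Nat.prime_dvd_prime_iff_eq hp.out Nat.prime_two).1 (by exact_mod_cast hd)))
    exact_mod_cast this
  set W : WeierstrassCurve ℤ_[p] := twoTorsionModel (p * (δ * A)) (p * (δ * B)) with hW
  have hiso : ∃ C' : VariableChange ℚ_[p], C' • E.baseChange ℚ_[p] = W.baseChange ℚ_[p] := by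
    simpa [hW] using exists_variableChange_baseChange hE p 1
  have hΔ : W.Δ = (p : ℤ_[p]) ^ 6 * (2 ^ 2 * (δ ^ 3 * (A * B * (A + B)))) ^ 2 := by
    rw [hW, twoTorsionModel_Δ]; ring
  have hc : W.c₄ = (p : ℤ_[p]) ^ 2 * (2 ^ 4 * (δ ^ 2 * (A ^ 2 + A * B + B ^ 2))) := by
    rw [hW, twoTorsionModel_c₄]; ring
  have hΔ0 : W.Δ ≠ 0 := by
    rw [hΔ]
    refine mul_ne_zero (pow_ne_zero _ hprime.ne_zero) (pow_ne_zero _ ?_)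
    exact_mod_cast mul_ne_zero (by norm_num) (mul_ne_zero (pow_ne_zero 3 hδ0) h0)
  have hT : ∃ T, IsTateModel E p W T := by
    rcases h with h | h
    · obtain ⟨k, β, rfl, hβ⟩ := exists_eq_pow_succ_mul (fun hB => h0 (by rw [hB]; ring)) h
      have hA : ¬ (p : ℤ) ∣ A := fun hA =>
        (Nat.prime_iff_prime_int.1 hp.out).not_isUnit (hAB.isUnit_of_dvd' hA h)
      have hA' : ¬ (p : ℤ_[p]) ∣ (A : ℤ_[p]) := mt natCast_dvd_intCast_padicInt_iff.1 hA
      refine ⟨.IStar (2 * k + 1 + 1), hiso,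
        isMinimal_baseChange_of_not_dvd_c₄ PadicInt.irreducible_p ?_, ?_⟩
      · rw [hc]
        refine fun hd => not_pow_succ_dvd_pow_mul hprime.ne_zero ?_ 2
          ((pow_dvd_pow _ (by norm_num)).trans hd)
        intro hd
        rcases hprime.dvd_or_dvd hd with hd | hd
        · exact h2 (hprime.dvd_of_dvd_pow hd)
        rcases hprime.dvd_or_dvd hd with hd | hd
        · exact hδ' (hprime.dvd_of_dvd_pow hd)
        -- Modulo p, A² + AB + B² is A², so c₄ has valuation exactly 2.
        have hB := natCast_dvd_intCast_padicInt_iff.2 h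
        rw [dvd_add_left (hB.pow two_ne_zero), dvd_add_left (hB.mul_left _)] at hd
        exact hA' (hprime.dvd_of_dvd_pow hd)
      · have := isTateForm_twoTorsionModel_IStar_even hprime hδ' hA'
          (mt natCast_dvd_intCast_padicInt_iff.1 hβ) k
        rw [hW]
        push_cast
        exact this
    · have h' : ¬ (p : ℤ_[p]) ∣ A * B * (A + B) := by
        have := mt natCast_dvd_intCast_padicInt_iff.1 h
        push_cast at this
        exact this
      refine ⟨_, hiso, isMinimal_baseChange_of_not_dvd_Δ PadicInt.irreducible_p ?_,
        isTateForm_twoTorsionModel_IStar_zero hprime hδ' h'⟩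
      rw [hΔ]
      refine fun hd => not_pow_succ_dvd_pow_mul hprime.ne_zero ?_ 6
          ((pow_dvd_pow _ (by norm_num)).trans hd)
      intro hd
      rcases hprime.dvd_or_dvd (hprime.dvd_of_dvd_pow hd) with hd | hd
      · exact h2 (hprime.dvd_of_dvd_pow hd)
      rcases hprime.dvd_or_dvd hd with hd | hd
      · exact hδ' (hprime.dvd_of_dvd_pow hd)
      · exact h' hd
  obtain ⟨T, hT⟩ := hT
  obtain ⟨W', T', v, -, -, h, -⟩ := exists_isTateModel_of_additive hT
    (hc ▸ (dvd_pow_self _ two_ne_zero).mul_right _)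
    (hΔ ▸ (dvd_pow_self _ (by norm_num)).mul_right _) hΔ0
  exact h

end WeierstrassCurve

/-! ### Excluded exponents at 2 -/

namespace PadicInt

theorem not_four_dvd_two : ¬ (4 : ℤ_[2]) ∣ 2 := by
  rintro ⟨x, hx⟩
  exact prime_two.not_dvd_one ⟨x, mul_left_cancel₀ prime_two.ne_zero (by linear_combination hx)⟩

theorem four_dvd_pow_six_sub_one {w : ℤ_[2]} (hw : Odd w) : 4 ∣ w ^ 6 - 1 := by
  obtain ⟨a, rfl⟩ := hw
  exact ⟨3 * (a ^ 2 + a) + 12 * (a ^ 2 + a) ^ 2 + 16 * (a ^ 2 + a) ^ 3, by ring⟩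

theorem odd_of_odd_mul_left {x y : ℤ_[2]} (h : Odd (x * y)) : Odd x := by
  rw [odd_iff_not_two_dvd] at h ⊢
  exact fun hd => h (hd.mul_right y)

theorem odd_intCast {x : ℤ} (hx : Odd x) : Odd (x : ℤ_[2]) := by
  obtain ⟨y, rfl⟩ := hx
  exact ⟨y, by push_cast; ring⟩

end PadicInt

namespace WeierstrassCurve

open PadicInt

/-- Kraus' conditions at `2` on the invariants of an integral Weierstrass equation. -/
theorem odd_c₄_and_c₆_or_dvd_c₄ (W : WeierstrassCurve ℤ_[2]) :
    (Odd W.c₄ ∧ 4 ∣ W.c₆ + 1) ∨ 2 ^ 4 ∣ W.c₄ := by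
  rcases even_or_odd W.a₁ with ⟨a, ha⟩ | ⟨a, ha⟩
  · refine .inr ⟨(a ^ 2 + W.a₂) ^ 2 - 3 * (W.a₄ + a * W.a₃), ?_⟩
    rw [c₄, b₂, b₄, ha]; ring
  · have e₂ : W.b₂ = 4 * (a ^ 2 + a + W.a₂) + 1 := by rw [b₂, ha]; ring
    generalize a ^ 2 + a + W.a₂ = x at e₂
    refine .inl ⟨⟨8 * x ^ 2 + 4 * x - 12 * W.b₄, ?_⟩,
      -(16 * x ^ 3 + 12 * x ^ 2 + 3 * x) + 9 * W.b₂ * W.b₄ - 54 * W.b₆, ?_⟩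
    · rw [c₄, e₂]; ring
    · rw [c₆, e₂]; ring

/-- Here 2¹² ∣ Δ, v(c₄) = 6 and 2⁹ ∣ c₆. An odd exponent would require 2⁷ ∣ c₄ or c₆/64 odd. -/
theorem not_odd_conductorExponent_two_of_ramified {E : WeierstrassCurve ℚ} {C : VariableChange ℚ}
    {δ A B : ℤ} (hE : C • E = twoTorsionModel ((2 * (δ * A) : ℤ) : ℚ) ((2 * (δ * B) : ℤ) : ℚ))
    (hδ : Odd δ) (hA : Odd A) (hB : 2 ∣ B) (h0 : A * B * (A + B) ≠ 0)
    (hodd : E.conductorExponent 2 < 2 ∨ Odd (E.conductorExponent 2))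
    (h5 : E.conductorExponent 2 ≤ 5) : False := by
  have hδ0 : δ ≠ 0 := by rintro rfl; simp at hδ
  set W : WeierstrassCurve ℤ_[2] := twoTorsionModel (2 * (δ * A)) (2 * (δ * B)) with hW
  have hiso : ∃ C' : VariableChange ℚ_[2], C' • E.baseChange ℚ_[2] = W.baseChange ℚ_[2] := by
    simpa [hW] using exists_variableChange_baseChange hE 2 1
  obtain ⟨k, β, rfl, hβ⟩ := exists_eq_pow_succ_mul (p := 2) (fun hB => h0 (by rw [hB]; ring)) hB
  obtain ⟨u, hu, hc⟩ : ∃ u, Odd u ∧ W.c₄ = 2 ^ 6 * u := by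
    refine ⟨δ ^ 2 * (A ^ 2 + 2 * (A * (2 ^ k * β) + 2 * (2 ^ k * β) ^ 2)), ?_, ?_⟩
    · exact (odd_intCast hδ).pow.mul ((odd_intCast hA).pow.add_even (even_two_mul _))
    · rw [hW, twoTorsionModel_c₄]; push_cast; ring
  obtain ⟨z, hc₆⟩ : ∃ z, W.c₆ = 2 ^ 9 * z := by
    refine ⟨-(δ ^ 3 * (2 ^ (k + 1) * β - A) * ((2 ^ (k + 1) * β - A) ^ 2 + 9 * (A * (2 ^ k * β)))),
      ?_⟩
    rw [hW, twoTorsionModel_c₆]; push_cast; ring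
  have hΔ : W.Δ = (2 ^ 6 * (δ ^ 3 * (A * (2 ^ k * β) * (A + 2 ^ (k + 1) * β)))) ^ 2 := by
    rw [hW, twoTorsionModel_Δ]; push_cast; ring
  have hΔ0 : W.Δ ≠ 0 := by
    have h' : ((4 * ((2 * (δ * A)) * (2 * (δ * ((2 : ℕ) ^ (k + 1) * β)))
        * (2 * (δ * A) + 2 * (δ * ((2 : ℕ) ^ (k + 1) * β)))) : ℤ) : ℤ_[2]) ≠ 0 := by
      rw [Int.cast_ne_zero]
      convert mul_ne_zero (mul_ne_zero (by norm_num : (32 : ℤ) ≠ 0) (pow_ne_zero 3 hδ0)) h0 using 1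
      ring
    rw [hW, twoTorsionModel_Δ]
    exact pow_ne_zero 2 (by exact_mod_cast h')
  have hm : IsMinimal ℤ_[2] (W.baseChange ℚ_[2]) := by
    refine isMinimal_baseChange_of_forall prime_two.irreducible fun W' w _ h4 _ => ?_
    have e : w ^ 4 * W'.c₄ = 2 ^ 2 * u := by
      apply mul_left_cancel₀ (pow_ne_zero 4 prime_two.ne_zero)
      linear_combination hc - h4
    have hn := not_two_pow_succ_dvd hu 2
    rw [← e] at hn
    -- A smaller equation would have w⁴c₄' of valuation 2, but by Kraus c₄' is odd or divisible by
    -- 16.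
    rcases W'.odd_c₄_and_c₆_or_dvd_c₄ with ⟨h, -⟩ | h
    · rcases even_or_odd w with hw | hw
      · exact hn (((pow_dvd_pow 2 (by norm_num)).trans
          (pow_dvd_pow_of_dvd hw.two_dvd 4)).mul_right _)
      · exact odd_iff_not_two_dvd.1 (hw.pow.mul h) ⟨2 * u, by rw [e]; ring⟩
    · exact hn (((pow_dvd_pow _ (by norm_num)).trans h).mul_left _)
  have hT : IsTateModel E 2 W (.IStar (2 * k + 1 + 1)) := by
    refine ⟨hiso, hm, ?_⟩
    have := isTateForm_twoTorsionModel_IStar_even prime_two (odd_iff_not_two_dvd.1 (odd_intCast hδ))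
      (odd_iff_not_two_dvd.1 (odd_intCast hA)) (mt natCast_dvd_intCast_padicInt_iff.1 hβ) k
    rw [hW]
    push_cast
    exact this
  obtain ⟨W', T', v, hT', hf, hf2, e1, e2, e3⟩ := exists_isTateModel_of_additive hT
    ⟨2 ^ 5 * u, by rw [hc]; push_cast; ring⟩
    ⟨2 ^ 11 * (δ ^ 3 * (A * (2 ^ k * β) * (A + 2 ^ (k + 1) * β))) ^ 2, by rw [hΔ]; push_cast; ring⟩
    hΔ0
  have hv := odd_unit v
  have e1' : W'.Δ = (v ^ 6 * (2 ^ 6 * (δ ^ 3 * (A * (2 ^ k * β) * (A + 2 ^ (k + 1) * β))))) ^ 2 := by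
    rw [e1, hΔ]; ring
  have h12 : 2 ^ 12 ∣ W'.Δ :=
    ⟨(v ^ 6 * (δ ^ 3 * (A * (2 ^ k * β) * (A + 2 ^ (k + 1) * β)))) ^ 2, by rw [e1']; ring⟩
  have hΔ' : W'.Δ ≠ 0 := by
    rw [e1]
    exact mul_ne_zero (pow_ne_zero _ v.ne_zero) hΔ0
  rw [Nat.cast_ofNat] at hT'
  rcases hT'.invariants_of_odd_conductorExponent
    ⟨v ^ 4 * 2 ^ 5 * u, by rw [e2, hc]; ring⟩ ((pow_dvd_pow _ (by norm_num)).trans h12)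
    hΔ' (e1' ▸ IsSquare.sq _) (hodd.resolve_left hf2.not_gt) h5 hf with
    ⟨h, -⟩ | ⟨-, h | ⟨y, hy, x, hx⟩⟩
  · exact h ((pow_dvd_pow _ (by norm_num)).trans h12)
  · rw [e2, hc, mul_left_comm] at h
    exact not_two_pow_succ_dvd (hv.pow.mul hu) 6 h
  · rw [e3, hc₆] at hy
    have : y = 8 * (v ^ 6 * z) := by
      apply mul_left_cancel₀ (pow_ne_zero 6 prime_two.ne_zero)
      linear_combination -hy
    exact prime_two.not_dvd_one ⟨2 * x - 4 * (v ^ 6 * z), by linear_combination hx - this⟩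

/-- Replacing y by y + x turns a₂ ≡ -1 mod 4 into a₂ ≡ 2 mod 4, at the cost of a₁ = 2. For residue
field 𝔽₂ the Tate cubic becomes T(T² + T + 1), which is separable. -/
theorem isTateForm_two_IStar_zero {R : Type*} [CommRing R] [IsDomain R] (h2 : Prime (2 : R))
    {s t : R} (ht : ¬ 2 ∣ t) :
    ((⟨1, 0, 1, 0⟩ : VariableChange R) • twoTorsionModel (4 * s + 1) (4 * t)).IsTateForm 2
      (.IStar 0) := by
  refine ⟨⟨1, ?_⟩, ⟨2 * t - 2 * s - 1, ?_⟩, ⟨0, ?_⟩, ⟨-((4 * s + 1) * t), ?_⟩, ⟨0, ?_⟩, ?_⟩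
  · simp [variableChange_def, twoTorsionModel]
  · simp [variableChange_def, twoTorsionModel]; ring
  · simp [variableChange_def, twoTorsionModel]
  · simp [variableChange_def, twoTorsionModel]; ring
  · simp [variableChange_def, twoTorsionModel]
  · convert not_pow_succ_dvd_pow_mul h2.ne_zero
      (x := ((2 * t - 2 * s - 1) * (4 * s + 1) * t) ^ 2 + 2 * (2 * ((4 * s + 1) * t) ^ 3)) ?_ 6
      using 2
    · simp [variableChange_def, twoTorsionModel]; ring
    · rw [dvd_add_left (dvd_mul_right 2 _)]
      intro hd
      rcases h2.dvd_or_dvd (h2.dvd_of_dvd_pow hd) with hd | hd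
      · refine h2.not_dvd_one ((dvd_add_right (dvd_mul_right 2 (4 * s * t - 4 * s ^ 2 + t
          - 3 * s - 1))).1 ?_)
        convert hd using 1
        ring
      · exact ht hd

theorem isTateForm_two_IStar_even {R : Type*} [CommRing R] [IsDomain R] (h2 : Prime (2 : R))
    {s t : R} (ht : ¬ 2 ∣ t) (k : ℕ) :
    ((⟨1, 0, 1, 0⟩ : VariableChange R) • twoTorsionModel (4 * s + 1)
      (4 * (2 ^ (k + 1) * t))).IsTateForm 2 (.IStar (2 * k + 1 + 1)) := by
  refine ⟨⟨1, ?_⟩, ⟨2 ^ (k + 2) * t - 2 * s - 1, ?_⟩, ?_, k, .inr ⟨rfl, ⟨0, ?_⟩,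
    ⟨-((4 * s + 1) * t), ?_⟩, ⟨0, ?_⟩, ?_⟩⟩
  · simp [variableChange_def, twoTorsionModel]
  · simp [variableChange_def, twoTorsionModel]; ring
  · convert not_pow_succ_dvd_pow_mul h2.ne_zero (x := 2 * (2 ^ (k + 1) * t - s - 1) + 1) ?_ 1
      using 2
    · simp [variableChange_def, twoTorsionModel]; ring
    · rw [dvd_add_right (dvd_mul_right 2 _)]
      exact h2.not_dvd_one
  · simp [variableChange_def, twoTorsionModel]
  · simp [variableChange_def, twoTorsionModel]; ring
  · simp [variableChange_def, twoTorsionModel]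
  · convert not_pow_succ_dvd_pow_mul h2.ne_zero (x := ((4 * s + 1) * t) ^ 2) ?_ (2 * k + 6)
      using 2
    · simp [variableChange_def, twoTorsionModel]; ring
    · intro hd
      rcases h2.dvd_or_dvd (h2.dvd_of_dvd_pow hd) with hd | hd
      · refine h2.not_dvd_one ((dvd_add_right (dvd_mul_right 2 (2 * s))).1 ?_)
        convert hd using 1
        ring
      · exact ht hd

/-- With B = 4t, c₆/64 ≡ 1 + 2t mod 4 and v(c₄) = 4. If t is odd then v(Δ) = 8, and an odd exponent
wants c₆/64 ≡ 1; if t is even then 2⁹ ∣ Δ, and it wants c₆/64 ≡ -1. Both are the wrong sign, and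
sixth powers of units, being 1 mod 4, cannot repair it. -/
theorem not_odd_conductorExponent_two {E : WeierstrassCurve ℚ} {C : VariableChange ℚ} {A B : ℤ}
    (hE : C • E = twoTorsionModel (A : ℚ) (B : ℚ)) (hA : A ≡ 1 [ZMOD 4]) (hB : 4 ∣ B)
    (h0 : A * B * (A + B) ≠ 0)
    (hodd : E.conductorExponent 2 < 2 ∨ Odd (E.conductorExponent 2))
    (h5 : E.conductorExponent 2 ≤ 5) : False := by
  obtain ⟨s, hs⟩ := hA.symm.dvd
  obtain ⟨t, rfl⟩ := hB
  obtain rfl : A = 4 * s + 1 := by omega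
  set W : WeierstrassCurve ℤ_[2] := (⟨1, 0, 1, 0⟩ : VariableChange ℤ_[2]) •
    twoTorsionModel (4 * (s : ℤ_[2]) + 1) (4 * (t : ℤ_[2])) with hW
  have hiso : ∃ C' : VariableChange ℚ_[2], C' • E.baseChange ℚ_[2] = W.baseChange ℚ_[2] := by
    simpa [hW] using exists_variableChange_baseChange hE 2 ⟨1, 0, 1, 0⟩
  have hA : Odd (4 * s + 1 : ℤ_[2]) := ⟨2 * s, by ring⟩
  have hAB : Odd (4 * s + 1 + 4 * t : ℤ_[2]) := ⟨2 * s + 2 * t, by ring⟩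
  obtain ⟨u, hu, hc⟩ : ∃ u, Odd u ∧ W.c₄ = 2 ^ 4 * u := by
    refine ⟨(4 * s + 1 : ℤ_[2]) ^ 2 + 2 * (2 * ((4 * s + 1) * t) + 8 * t ^ 2), ?_, ?_⟩
    · exact hA.pow.add_even (even_two_mul _)
    · rw [hW, variableChange_c₄, twoTorsionModel_c₄]; simp only [inv_one, Units.val_one]; ring
  obtain ⟨y₀, hc₆, z, hz⟩ : ∃ y₀, W.c₆ = 64 * y₀ ∧ 4 ∣ y₀ - (1 + 2 * t) := by
    refine ⟨-(4 * t - (4 * s + 1) : ℤ_[2]) ^ 3 - 18 * ((4 * s + 1) * t * (4 * t - (4 * s + 1))), ?_,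
      -(16 * (t - s : ℤ_[2]) ^ 3 - 12 * (t - s) ^ 2 + 3 * (t - s)) + 4 * t
        - 18 * t * (4 * s * (t - s) - s + (t - s)), by ring⟩
    rw [hW, variableChange_c₆, twoTorsionModel_c₆]; simp only [inv_one, Units.val_one]; ring
  have hΔ : W.Δ = (2 ^ 4 * ((4 * (s : ℤ_[2]) + 1) * t * (4 * s + 1 + 4 * t))) ^ 2 := by
    rw [hW, variableChange_Δ, twoTorsionModel_Δ]; simp only [inv_one, Units.val_one]; ring
  have hΔ0 : W.Δ ≠ 0 := by
    rw [hΔ]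
    refine pow_ne_zero 2 (mul_ne_zero (pow_ne_zero _ prime_two.ne_zero) ?_)
    have : (4 * s + 1) * t * (4 * s + 1 + 4 * t) ≠ 0 := fun h => h0 (by linear_combination 4 * h)
    exact_mod_cast this
  have hT : ∃ T, IsTateModel E 2 W T := by
    by_cases ht : 2 ∣ t
    · have ht0 : t ≠ 0 := by rintro rfl; simp at h0
      have hm : IsMinimal ℤ_[2] (W.baseChange ℚ_[2]) := by
        refine isMinimal_baseChange_of_forall prime_two.irreducible fun W' w _ h4 h6 => ?_
        have e : w ^ 4 * W'.c₄ = u := by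
          apply mul_left_cancel₀ (pow_ne_zero 4 prime_two.ne_zero)
          linear_combination hc - h4
        have e' : w ^ 6 * W'.c₆ = y₀ := by
          apply mul_left_cancel₀ (pow_ne_zero 6 prime_two.ne_zero)
          linear_combination hc₆ - h6
        rw [← e] at hu
        have hw : Odd w := by
          rw [pow_succ', mul_assoc] at hu
          exact odd_of_odd_mul_left hu
        -- As w⁴c₄' is odd, Kraus gives c₆' ≡ -1 mod 4; since w⁶ ≡ 1, this contradicts c₆/64 ≡ 1 for
        -- even t.
        rcases W'.odd_c₄_and_c₆_or_dvd_c₄ with ⟨-, x, hx⟩ | h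
        · obtain ⟨r, hr⟩ := four_dvd_pow_six_sub_one hw
          obtain ⟨l, rfl⟩ := ht
          push_cast at hz
          exact not_four_dvd_two ⟨w ^ 6 * x - z - l - r,
            by linear_combination w ^ 6 * hx - hr - hz - e'⟩
        · exact odd_iff_not_two_dvd.1 hu (((dvd_pow_self 2 (by norm_num)).trans h).mul_left _)
      obtain ⟨k, β, rfl, hβ⟩ := exists_eq_pow_succ_mul (p := 2) ht0 ht
      refine ⟨.IStar (2 * k + 1 + 1), hiso, hm, ?_⟩
      have := isTateForm_two_IStar_even prime_two (s := (s : ℤ_[2]))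
        (mt natCast_dvd_intCast_padicInt_iff.1 hβ) k
      rw [hW]
      push_cast
      exact this
    · have ht' : Odd (t : ℤ_[2]) := odd_intCast (Int.not_even_iff_odd.1 (by rwa [even_iff_two_dvd]))
      refine ⟨.IStar 0, hiso, isMinimal_baseChange_of_not_dvd_Δ prime_two.irreducible ?_,
        isTateForm_two_IStar_zero prime_two (odd_iff_not_two_dvd.1 ht')⟩
      intro hd
      refine not_two_pow_succ_dvd (((hA.mul ht').mul hAB).pow (n := 2)) 8
        (((pow_dvd_pow 2 (by norm_num)).trans hd).trans (dvd_of_eq ?_))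
      rw [hΔ]; ring
  obtain ⟨T, hT⟩ := hT
  obtain ⟨W', T', v, hT', hf, hf2, e1, e2, e3⟩ := exists_isTateModel_of_additive hT
    ⟨2 ^ 3 * u, by rw [hc]; push_cast; ring⟩
    ⟨2 ^ 7 * ((4 * (s : ℤ_[2]) + 1) * t * (4 * s + 1 + 4 * t)) ^ 2, by rw [hΔ]; push_cast; ring⟩ hΔ0
  have hv := odd_unit v
  have e1' : W'.Δ = (v ^ 6 * (2 ^ 4 * ((4 * s + 1) * t * (4 * s + 1 + 4 * t)))) ^ 2 := by
    rw [e1, hΔ]; ring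
  have hΔ' : W'.Δ ≠ 0 := by
    rw [e1]
    exact mul_ne_zero (pow_ne_zero _ v.ne_zero) hΔ0
  have hc' (n : ℕ) : ¬ 2 ^ (n + 5) ∣ W'.c₄ := by
    rw [e2, hc, mul_left_comm]
    exact fun hd => not_two_pow_succ_dvd (hv.pow.mul hu) 4 ((pow_dvd_pow 2 (by omega)).trans hd)
  have hc₆' {y : ℤ_[2]} (hy : W'.c₆ = 64 * y) : y = v ^ 6 * y₀ := by
    apply mul_left_cancel₀ (pow_ne_zero 6 prime_two.ne_zero)
    linear_combination -hy + e3 + v ^ 6 * hc₆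
  obtain ⟨r, hr⟩ := four_dvd_pow_six_sub_one hv
  rw [Nat.cast_ofNat] at hT'
  rcases hT'.invariants_of_odd_conductorExponent
    ⟨v ^ 4 * 2 ^ 3 * u, by rw [e2, hc]; ring⟩
    ⟨(v ^ 6 * ((4 * s + 1) * t * (4 * s + 1 + 4 * t))) ^ 2, by rw [e1']; ring⟩
    hΔ' (e1' ▸ IsSquare.sq _) (hodd.resolve_left hf2.not_gt) h5 hf with
    ⟨h9, h | ⟨y, hy, x, hx⟩⟩ | ⟨h9, h | ⟨y, hy, x, hx⟩⟩
  · exact hc' 1 h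
  · rcases even_or_odd (t : ℤ_[2]) with ⟨l, hl⟩ | ⟨l, hl⟩
    · refine h9 ⟨2 * (v ^ 6 * ((4 * s + 1) * l * (4 * s + 1 + 4 * t))) ^ 2, ?_⟩
      rw [e1']
      linear_combination 2 ^ 8 * (v ^ 6 * ((4 * s + 1) * (4 * s + 1 + 4 * t))) ^ 2
        * (t + 2 * l) * hl
    · refine not_four_dvd_two ⟨x - r * y₀ - z - l, ?_⟩
      linear_combination hx - hc₆' hy - y₀ * hr - hz - 2 * hl
  · exact hc' 2 h
  · rcases even_or_odd (t : ℤ_[2]) with ⟨l, hl⟩ | ht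
    · refine not_four_dvd_two ⟨x - r * y₀ - z - l, ?_⟩
      linear_combination hx - hc₆' hy - y₀ * hr - hz - 2 * hl
    · refine not_two_pow_succ_dvd ((hv.pow (n := 6)).mul ((hA.mul ht).mul hAB) |>.pow (n := 2)) 8
        (h9.trans (dvd_of_eq ?_))
      rw [e1']; ring

end WeierstrassCurve

namespace WeierstrassCurve

/-! ### Local exponents as valuations of the conductor -/

section Conductor

variable {E : WeierstrassCurve ℚ} {C : VariableChange ℚ} {a b : ℤ}

theorem conductorExponent_eq_zero_of_not_dvd (hE : C • E = twoTorsionModel (a : ℚ) (b : ℚ)) {p : ℕ}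
    [Fact p.Prime] (hp : ¬ (p : ℤ) ∣ 4 * (a * b * (a + b))) : E.conductorExponent p = 0 := by
  set W : WeierstrassCurve ℤ_[p] := twoTorsionModel (a : ℤ_[p]) (b : ℤ_[p]) with hW
  have hiso : ∃ C' : VariableChange ℚ_[p], C' • E.baseChange ℚ_[p] = W.baseChange ℚ_[p] := by
    simpa [hW] using exists_variableChange_baseChange hE p 1
  have hΔ : ¬ (p : ℤ_[p]) ∣ W.Δ := by
    rw [hW, twoTorsionModel_Δ]
    intro hd
    have := PadicInt.prime_p.dvd_of_dvd_pow hd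
    exact hp (natCast_dvd_intCast_padicInt_iff.1 (by exact_mod_cast this))
  exact conductorExponent_eq_zero ⟨hiso, isMinimal_baseChange_of_not_dvd_Δ PadicInt.irreducible_p
    fun hd => hΔ ((dvd_pow_self _ (by norm_num)).trans hd), hΔ⟩

/-- Splitting off the factor at p from `∏ᶠ` needs finite support, which holds as the exponent
vanishes at primes not dividing 4ab(a + b). -/
theorem exists_conductor_eq (hE : C • E = twoTorsionModel (a : ℚ) (b : ℚ))
    (h0 : a * b * (a + b) ≠ 0) (p : ℕ) [hp : Fact p.Prime] :
    ∃ m, ¬ p ∣ m ∧ E.conductor = p ^ E.conductorExponent p * m := by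
  set F : Nat.Primes → ℕ := fun q =>
    (q : ℕ) ^ (haveI : Fact (q : ℕ).Prime := ⟨q.2⟩; E.conductorExponent (q : ℕ)) with hF
  have hfin : F.mulSupport.Finite := by
    refine (((4 * (a * b * (a + b))).natAbs.divisors.finite_toSet).preimage
      (f := ((↑) : Nat.Primes → ℕ)) Subtype.val_injective.injOn).subset fun q hq => ?_
    by_contra hn
    have : Fact (q : ℕ).Prime := ⟨q.2⟩
    refine hq ?_
    have : ¬ ((q : ℕ) : ℤ) ∣ 4 * (a * b * (a + b)) := by
      intro hd
      apply hn
      simp only [Set.mem_preimage, Finset.mem_coe, Nat.mem_divisors]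
      exact ⟨Int.natCast_dvd.1 hd, by simpa using h0⟩
    simp only [hF]
    rw [conductorExponent_eq_zero_of_not_dvd hE this, pow_zero]
  let P : Nat.Primes := ⟨p, hp.out⟩
  refine ⟨∏ᶠ (q) (_ : q ≠ P), F q, ?_, (mul_finprod_cond_ne P hfin).symm⟩
  have hmul (x y : ℕ) (hx : ¬ p ∣ x) (hy : ¬ p ∣ y) : ¬ p ∣ x * y :=
    fun hd => (hp.out.dvd_mul.1 hd).elim hx hy
  have hone : ¬ p ∣ 1 := hp.out.one_lt.ne' ∘ Nat.dvd_one.1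
  refine finprod_induction (¬ p ∣ ·) hone hmul fun q =>
    finprod_induction (¬ p ∣ ·) hone hmul fun hq hd => hq ?_
  exact Subtype.ext ((Nat.prime_dvd_prime_iff_eq hp.out q.2).1 (hp.out.dvd_of_dvd_pow hd)).symm

end Conductor

/-! ### Normal forms for curves with full rational 2-torsion -/

section Normalization

variable {E : WeierstrassCurve ℚ}

theorem exists_twoTorsionModel_cyclic {a b : ℚ} (h : ∃ C : VariableChange ℚ,
    C • E = twoTorsionModel a b) : ∃ C : VariableChange ℚ, C • E = twoTorsionModel (-(a + b)) a := by
  obtain ⟨C, hC⟩ := h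
  refine ⟨⟨1, a, 0, 0⟩ * C, ?_⟩
  rw [mul_smul, hC]
  ext <;> simp only [variableChange_def, twoTorsionModel, inv_one, Units.val_one] <;> ring

theorem exists_twoTorsionModel_swap {a b : ℚ} (h : ∃ C : VariableChange ℚ,
    C • E = twoTorsionModel a b) : ∃ C : VariableChange ℚ, C • E = twoTorsionModel (a + b) (-b) := by
  obtain ⟨C, hC⟩ := h
  refine ⟨⟨1, -b, 0, 0⟩ * C, ?_⟩
  rw [mul_smul, hC]
  ext <;> simp only [variableChange_def, twoTorsionModel, inv_one, Units.val_one] <;> ring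

theorem exists_twoTorsionModel_scale {a b w : ℚ} (hw : w ≠ 0) (h : ∃ C : VariableChange ℚ,
    C • E = twoTorsionModel (a * w ^ 2) (b * w ^ 2)) :
    ∃ C : VariableChange ℚ, C • E = twoTorsionModel a b := by
  obtain ⟨C, hC⟩ := h
  refine ⟨⟨Units.mk0 w hw, 0, 0, 0⟩ * C, ?_⟩
  rw [mul_smul, hC]
  ext <;> simp only [variableChange_def, twoTorsionModel, Units.val_inv_eq_inv_val, Units.val_mk0]
    <;> field_simp <;> ring

theorem two_mul_y_of_two_nsmul_eq_zero {P : E.toAffine.Point} (hP : (2 : ℕ) • P = 0) (h0 : P ≠ 0) :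
    ∃ x y, ∃ h : E.toAffine.Nonsingular x y, P = .some x y h ∧ 2 * y = -(E.a₁ * x) - E.a₃ := by
  match P, h0, hP with
  | .some x y h, _, hP =>
    refine ⟨x, y, h, rfl, ?_⟩
    rw [two_nsmul, ← eq_neg_iff_add_eq_zero, Affine.Point.neg_some] at hP
    have := (Affine.Point.some.inj hP).2
    rw [Affine.negY] at this
    linear_combination this

/-- The nonzero 2-torsion points satisfy 2y + a₁x + a₃ = 0, so their x-coordinates are three
distinct roots of 4x³ + b₂x² + 2b₄x + b₆. Dividing differences of these equations gives the Vieta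
relations. -/
theorem HasFullRationalTwoTorsion.exists_twoTorsionModel (h : E.HasFullRationalTwoTorsion) :
    ∃ (a b : ℚ) (C : VariableChange ℚ), C • E = twoTorsionModel a b := by
  obtain ⟨e⟩ := h
  have key (z : ZMod 2 × ZMod 2) (hz : z ≠ 0) := two_mul_y_of_two_nsmul_eq_zero
    (P := (e.symm z : E.toAffine.Point)) 
    (by rw [← natCast_zsmul]; exact (Submodule.mem_torsionBy_iff _ _).1 (e.symm z).2)
    (by simpa using hz)
  obtain ⟨x₁, y₁, n₁, e₁, h₁⟩ := key (1, 0) (by decide)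
  obtain ⟨x₂, y₂, n₂, e₂, h₂⟩ := key (0, 1) (by decide)
  obtain ⟨x₃, y₃, n₃, e₃, h₃⟩ := key (1, 1) (by decide)
  have ne {z z' : ZMod 2 × ZMod 2} (hz : z ≠ z') {x x' y y' n n'}
      (he : (e.symm z : E.toAffine.Point) = .some x y n)
      (he' : (e.symm z' : E.toAffine.Point) = .some x' y' n')
      (hy : 2 * y = -(E.a₁ * x) - E.a₃) (hy' : 2 * y' = -(E.a₁ * x') - E.a₃) : x - x' ≠ 0 := by
    intro hx
    obtain rfl := sub_eq_zero.1 hx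
    obtain rfl : y = y' := by linarith
    exact hz (e.symm.injective (Subtype.ext (he.trans he'.symm)))
  have n12 := ne (by decide) e₁ e₂ h₁ h₂
  have n13 := ne (by decide) e₁ e₃ h₁ h₃
  have n23 := ne (by decide) e₂ e₃ h₂ h₃
  have q {x y} (n : E.toAffine.Nonsingular x y) (hy : 2 * y = -(E.a₁ * x) - E.a₃) :
      4 * x ^ 3 + E.b₂ * x ^ 2 + 2 * E.b₄ * x + E.b₆ = 0 := by
    have := (Affine.equation_iff _ _).1 n.1
    rw [b₂, b₄, b₆]
    linear_combination -4 * this + (2 * y + E.a₁ * x + E.a₃) * hy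
  have q12 : 4 * (x₁ ^ 2 + x₁ * x₂ + x₂ ^ 2) + E.b₂ * (x₁ + x₂) + 2 * E.b₄ = 0 :=
    mul_left_cancel₀ n12 (by linear_combination q n₁ h₁ - q n₂ h₂)
  have q13 : 4 * (x₁ ^ 2 + x₁ * x₃ + x₃ ^ 2) + E.b₂ * (x₁ + x₃) + 2 * E.b₄ = 0 :=
    mul_left_cancel₀ n13 (by linear_combination q n₁ h₁ - q n₃ h₃)
  have q123 : 4 * (x₁ + x₂ + x₃) + E.b₂ = 0 :=
    mul_left_cancel₀ n23 (by linear_combination q12 - q13)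
  have eq₁ := (Affine.equation_iff _ _).1 n₁.1
  rw [b₂] at q123
  rw [b₂, b₄] at q12
  -- The first point goes to the origin, s = -a₁/2 kills a₁, and the other roots become x₂ - x₁ and
  -- x₃ - x₁.
  refine ⟨x₂ - x₁, x₁ - x₃, ⟨1, x₁, -E.a₁ / 2, y₁⟩, ?_⟩
  ext <;> simp only [variableChange_def, twoTorsionModel, inv_one, Units.val_one]
  · ring
  · linear_combination q123 / 4
  · linear_combination h₁
  · linear_combination q12 / 4 + (x₁ - x₂) / 4 * q123
  · linear_combination -eq₁

theorem exists_squarefree_mul_sq (q : ℚ) (hq : q ≠ 0) :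
    ∃ (d : ℤ) (w : ℚ), Squarefree d ∧ w ≠ 0 ∧ q = d * w ^ 2 := by
  obtain ⟨s, t, hst, hs⟩ := Nat.sq_mul_squarefree (q.num.natAbs * q.den)
  have hnum : q.num ≠ 0 := Rat.num_ne_zero.2 hq
  have hden : (q.den : ℚ) ≠ 0 := by exact_mod_cast q.den_ne_zero
  have ht : t ≠ 0 := by
    rintro rfl
    rw [zero_pow two_ne_zero, zero_mul, eq_comm, mul_eq_zero, Int.natAbs_eq_zero] at hst
    exact hst.elim hnum q.den_ne_zero
  have hst' : (t : ℚ) ^ 2 * s = (q.num.natAbs : ℚ) * q.den := by exact_mod_cast hst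
  refine ⟨q.num.sign * s, t / q.den, ?_, div_ne_zero (by exact_mod_cast ht) hden, ?_⟩
  · rw [← Int.squarefree_natAbs, Int.natAbs_mul, Int.natAbs_sign_of_ne_zero hnum, one_mul]
    simpa using hs
  · have hsign : (q.num : ℚ) = q.num.sign * q.num.natAbs := by
      rw [← Int.cast_natCast, ← Int.cast_mul, Int.sign_mul_natAbs]
    have : q * q.den = q.num := Rat.mul_den_eq_num q
    rw [Int.cast_mul, Int.cast_natCast]
    field_simp
    linear_combination q.den * this + q.den * hsign - q.num.sign * hst'

/-- Every elliptic curve over `ℚ` with full rational `2`-torsion is a squarefree quadratic twist of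
a curve `Y² = X (X - A) (X + B)` with `A` and `B` coprime. -/
theorem HasFullRationalTwoTorsion.exists_squarefree_twist [E.IsElliptic]
    (h : E.HasFullRationalTwoTorsion) :
    ∃ d A B : ℤ, Squarefree d ∧ IsCoprime A B ∧ A * B * (A + B) ≠ 0 ∧
      ∃ C : VariableChange ℚ, C • E = twoTorsionModel ((d * A : ℤ) : ℚ) ((d * B : ℤ) : ℚ) := by
  obtain ⟨a, b, hab⟩ := h.exists_twoTorsionModel
  have hne : a * b * (a + b) ≠ 0 := by
    obtain ⟨C, hC⟩ := hab
    have hΔ : (C • E).Δ ≠ 0 := (C • E).isUnit_Δ.ne_zero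
    rw [hC, twoTorsionModel_Δ] at hΔ
    exact fun h0 => hΔ (by rw [h0]; ring)
  have hb : b ≠ 0 := by rintro rfl; simp at hne
  set A := (a / b).num with hA
  set B : ℤ := ((a / b).den : ℤ) with hB
  have hB0 : (B : ℚ) ≠ 0 := by simp [hB]
  have hcop : IsCoprime A B := by
    rw [Int.isCoprime_iff_nat_coprime]
    simpa [hA, hB] using (a / b).reduced
  have hAB : a / b = A / B := by
    simpa [hA, hB] using (Rat.num_div_den (a / b)).symm
  -- As a/b = A/B in lowest terms, the one factor b/B carries (A, B) to (a, b); `d` is its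
  -- squarefree part.
  obtain ⟨d, w, hd, hw, hq⟩ := exists_squarefree_mul_sq (b / B) (div_ne_zero hb hB0)
  have eb : b = d * B * w ^ 2 := by
    field_simp at hq
    linear_combination hq
  have ea : a = d * A * w ^ 2 := by
    have : a = A / B * b := by rw [← hAB]; field_simp
    rw [this, eb]; field_simp
  refine ⟨d, A, B, hd, hcop, fun h0 => hne ?_, ?_⟩
  · have h0' : (A : ℚ) * B * (A + B) = 0 := by exact_mod_cast h0
    rw [ea, eb]
    linear_combination (d : ℚ) ^ 3 * w ^ 6 * h0'
  · refine exists_twoTorsionModel_scale hw ?_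
    push_cast
    rwa [← ea, ← eb]

/-- Permuting the `2`-torsion points, one may assume that a given prime divides `B` if it divides
the discriminant. -/
theorem exists_twoTorsionModel_dvd {d A B : ℤ} (hAB : IsCoprime A B) (h0 : A * B * (A + B) ≠ 0)
    (h : ∃ C : VariableChange ℚ, C • E = twoTorsionModel ((d * A : ℤ) : ℚ) ((d * B : ℤ) : ℚ))
    {p : ℤ} (hp : Prime p) :
    ∃ A' B' : ℤ, IsCoprime A' B' ∧ A' * B' * (A' + B') ≠ 0 ∧
      (∃ C : VariableChange ℚ, C • E = twoTorsionModel ((d * A' : ℤ) : ℚ) ((d * B' : ℤ) : ℚ)) ∧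
      (p ∣ B' ∨ ¬ p ∣ A' * B' * (A' + B')) := by
  by_cases hd : p ∣ A * B * (A + B)
  swap
  · exact ⟨A, B, hAB, h0, h, .inr hd⟩
  have h1 := exists_twoTorsionModel_cyclic h
  rcases hp.dvd_or_dvd hd with hd | hd
  · rcases hp.dvd_or_dvd hd with hd | hd
    · refine ⟨-(A + B), A, ?_, fun h' => h0 ?_, ?_, .inl hd⟩
      · rw [IsCoprime.neg_left_iff, isCoprime_comm]
        simpa using hAB.mul_add_left_right 1
      · linear_combination h'
      · convert h1 using 4
        push_cast; ring
    · exact ⟨A, B, hAB, h0, h, .inl hd⟩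
  · refine ⟨B, -(A + B), ?_, fun h' => h0 ?_, ?_, .inl (hd.neg_right)⟩
    · rw [IsCoprime.neg_right_iff]
      simpa using hAB.symm.add_mul_left_right 1
    · linear_combination h'
    · convert exists_twoTorsionModel_cyclic h1 using 4 <;> push_cast <;> ring

end Normalization

theorem freyModel_eq_twoTorsionModel (A B : ℤ) :
    freyModel A B = twoTorsionModel (A : ℚ) (B : ℚ) := by
  ext <;> simp [freyModel, twoTorsionModel]

/-- One of A, B, A + B is always even, so the prime 2 can always be moved into B; coprimality then
makes A odd. -/
theorem exists_twoTorsionModel_two_dvd {E : WeierstrassCurve ℚ} {d A B : ℤ} (hAB : IsCoprime A B)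
    (h0 : A * B * (A + B) ≠ 0)
    (h : ∃ C : VariableChange ℚ, C • E = twoTorsionModel ((d * A : ℤ) : ℚ) ((d * B : ℤ) : ℚ)) :
    ∃ A' B' : ℤ, IsCoprime A' B' ∧ A' * B' * (A' + B') ≠ 0 ∧ Odd A' ∧ 2 ∣ B' ∧
      ∃ C : VariableChange ℚ, C • E = twoTorsionModel ((d * A' : ℤ) : ℚ) ((d * B' : ℤ) : ℚ) := by
  obtain ⟨A', B', hAB', h0', h', hd⟩ := exists_twoTorsionModel_dvd hAB h0 h Int.prime_two
  have hB : 2 ∣ B' := by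
    refine hd.resolve_right fun hn => hn ?_
    rcases Int.even_or_odd A' with hA | hA
    · exact (hA.two_dvd.mul_right _).mul_right _
    rcases Int.even_or_odd B' with hB | hB
    · exact (hB.two_dvd.mul_left _).mul_right _
    · exact (hA.add_odd hB).two_dvd.mul_left _
  refine ⟨A', B', hAB', h0', ?_, hB, h'⟩
  rw [← Int.not_even_iff_odd, even_iff_two_dvd]
  exact fun hA => Int.prime_two.not_isUnit (hAB'.isUnit_of_dvd' hA hB)

end WeierstrassCurve

/-! ### Assembling the theorem -/

open WeierstrassCurve

theorem lemma2p2 (r : ℕ) (hr : r = 0 ∨ r = 1 ∨ r = 3 ∨ r = 5)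
    (N : ℤ) (hN_odd : Odd N) (hN_sqf : Squarefree N)
    (E : WeierstrassCurve ℚ) [E.IsElliptic]
    (hE_cond : (E.conductor : ℤ) = 2 ^ r * N)
    (hE_two : E.HasFullRationalTwoTorsion) :
    ∃ A B : ℤ, IsCoprime A B ∧ A ≡ -1 [ZMOD 4] ∧ 2 ∣ B ∧
      ∃ C : WeierstrassCurve.VariableChange ℚ, C • E = WeierstrassCurve.freyModel A B := by
  obtain ⟨d, A, B, hd, hAB, h0, hE⟩ := hE_two.exists_squarefree_twist
  have hd0 : d ≠ 0 := hd.ne_zero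
  have hcond (p : ℕ) [Fact p.Prime] : ∃ m : ℤ, ¬ (p : ℤ) ∣ m ∧
      (p : ℤ) ^ E.conductorExponent p * m = 2 ^ r * N := by
    obtain ⟨C, hC⟩ := hE
    obtain ⟨m, hm, e⟩ := exists_conductor_eq hC (by
      convert mul_ne_zero (pow_ne_zero 3 hd0) h0 using 1; ring) p
    exact ⟨m, by exact_mod_cast hm, by rw [← hE_cond, e]; push_cast; rfl⟩
  have h2 : E.conductorExponent 2 = r := by
    obtain ⟨m, hm, e⟩ := hcond 2
    have hN : ¬ (2 : ℤ) ∣ N := by rwa [← even_iff_two_dvd, Int.not_even_iff_odd]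
    rw [Nat.cast_ofNat] at e hm
    rcases lt_trichotomy (E.conductorExponent 2) r with h | h | h
    · exact absurd ((pow_dvd_pow 2 h).trans (e ▸ dvd_mul_right _ _))
        (not_pow_succ_dvd_pow_mul two_ne_zero hm _)
    · exact h
    · exact absurd ((pow_dvd_pow 2 h).trans (e ▸ dvd_mul_right _ _))
        (not_pow_succ_dvd_pow_mul two_ne_zero hN _)
  have hodd : E.conductorExponent 2 < 2 ∨ Odd (E.conductorExponent 2) := by
    rw [h2]
    rcases hr with rfl | rfl | rfl | rfl <;> decide
  have h5 : E.conductorExponent 2 ≤ 5 := by omega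
  have hcopr {p δ : ℤ} (hp : Prime p) (hδ : d = p * δ) : ¬ p ∣ δ := by
    rintro ⟨x, rfl⟩
    exact hp.not_isUnit (hd p ⟨x, by rw [hδ, mul_assoc]⟩)
  have hunit : IsUnit d := by
    rw [Int.isUnit_iff_natAbs_eq]
    by_contra hd1
    obtain ⟨p, hp, hpd⟩ := Nat.exists_prime_and_dvd hd1
    have : Fact p.Prime := ⟨hp⟩
    have hp' := Nat.prime_iff_prime_int.1 hp
    obtain ⟨δ, hδ⟩ := Int.natCast_dvd.2 hpd
    have hpδ := hcopr hp' hδ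
    by_cases hp2 : p = 2
    · subst hp2
      obtain ⟨A', B', -, h0', hA', hB', C, hC⟩ := exists_twoTorsionModel_two_dvd hAB h0 hE
      refine not_odd_conductorExponent_two_of_ramified (C := C) (δ := δ) ?_ ?_ hA' hB' h0' hodd h5
      · rw [hC, hδ, mul_assoc, mul_assoc]; rfl
      · rwa [← Int.not_even_iff_odd, even_iff_two_dvd]
    · obtain ⟨A', B', hAB', h0', ⟨C, hC⟩, hB'⟩ := exists_twoTorsionModel_dvd hAB h0 hE hp'
      have hle := two_le_conductorExponent hp2 (by rw [hC, hδ, mul_assoc, mul_assoc]) hAB' hpδ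
        h0' hB'
      obtain ⟨m, -, e⟩ := hcond p
      have hdvd : (p : ℤ) ^ 2 ∣ 2 ^ r * N := (pow_dvd_pow _ hle).trans (e ▸ dvd_mul_right _ _)
      have hc : IsCoprime ((p : ℤ) ^ 2) (2 ^ r) := by
        refine IsCoprime.pow ?_
        exact_mod_cast Nat.isCoprime_iff_coprime.2 ((Nat.coprime_primes hp Nat.prime_two).2 hp2)
      exact hp'.not_isUnit (hN_sqf p (by rw [← pow_two]; exact hc.dvd_of_dvd_mul_left hdvd))
  -- The sign d = ±1 is absorbed into A and B, leaving the trivial twist.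
  obtain ⟨A, B, hAB, h0, hA, hB, C, hC⟩ := exists_twoTorsionModel_two_dvd (E := E) (d := 1)
    (A := d * A) (B := d * B)
    ((isCoprime_mul_unit_left hunit A B).2 hAB)
    (by convert mul_ne_zero (pow_ne_zero 3 hd0) h0 using 1; ring) (by simpa using hE)
  rw [one_mul, one_mul] at hC
  simp only [freyModel_eq_twoTorsionModel]
  rcases (by obtain ⟨k, rfl⟩ := hA; omega : A % 4 = 1 ∨ A % 4 = 3) with hA | hA
  · by_cases hB4 : 4 ∣ B
    · exact (not_odd_conductorExponent_two hC hA hB4 h0 hodd h5).elim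
    · refine ⟨A + B, -B, ?_, ?_, hB.neg_right, ?_⟩
      · rw [IsCoprime.neg_right_iff]
        simpa using hAB.add_mul_left_left 1
      · simp only [Int.ModEq]; omega
      · simpa using exists_twoTorsionModel_swap ⟨C, hC⟩
  · exact ⟨A, B, hAB, by simp only [Int.ModEq]; omega, hB, C, hC⟩
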